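/- Let $K$ be a field of characteristic zero, $V$ a $K$-vector space of finite dimension $r\ge 1$, $U=V^*$, and $X=(x_1,\dots,x_N)$ a finite sequence that spans $U$. Flats, closures and ranks of subsequences are those of the matroid of $X$; a hyperplane is a flat of rank $r-1$, and $H_1,\dots,H_m$ are the hyperplanes of $X$. For each $i$ let $D_i\in V$ be a defining normal of $H_i$, that is $H_i=\{x\in X: x(D_i)=0\}$. Let $G=\{\lambda\in K^m:\sum_i\lambda_iD_i=0\}$ act on $K[s_1,\dots,s_m,t_1,\dots,t_m]$ by $s_i\mapsto s_i$, $t_i\mapsto t_i+\lambda_is_i$, and let $R^G$ be the ring of invariants (the Cox–Nagata ring). For $(d,u)\in\mathbb Z^{m+1}$ let $R^G_{(d,u)}$ be the space of invariants that are homogeneous of degree $(d,u)$ for the grading $\deg s_i=(0,e_i)$, $\deg t_i=(1,e_i)$. Let $\mathfrak H\in\{0,1\}^{m\times N}$ be the matrix with $\mathfrak H_{ij}=1$ if and only if $x_j\notin H_i$. Let $a\in\mathbb N^N$ (with $0\in\mathbb N$), let $X(a)$ be the sequence obtained from $X$ by replacing each $x_j$ by $a_j$ copies of itself, and let $e=(1,\dots,1)\in\mathbb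 N^m$. For a finite sequence $Y$ in $U$, an integer $k$ and a set $J$ of flats of $Y$, let $$I(Y,k,J)=\mathrm{ideal}\{D_\eta^{\,m(\eta)+k+\chi(\eta)}:\eta\in V\setminus\{0\}\}\subseteq \mathrm{Sym}(V),$$ where $D_\eta$ is the image of $\eta$ in $\mathrm{Sym}(V)$, $m(\eta)$ is the number of entries $y$ of $Y$ with $y(\eta)\neq0$, and $\chi(\eta)=1$ if the flat $\{y\in Y:y(\eta)=0\}$ belongs to $J$ and $\chi(\eta)=0$ otherwise. (If $k=-1$ and $Y$ does not span $U$, a negative exponent is read as $0$.) The algebra $\mathrm{Sym}(V)$ acts on $\mathrm{Sym}(U)$ by differential operators, where $v\in V$ acts as the derivation $\partial_v$ with $\partial_v(u)=u(v)$ for $u\in U$; the pairing $\langle f,q\rangle$ is the degree-zero component of $q\cdot f$. For an ideal $I\subseteq\mathrm{Sym}(V)$ put $\ker I=\{f\in\mathrm{Sym}(U):\langle f,q\rangle=0\text{ for all }q\in I\}$, and let $(\ker I)_d$ be the set of its elements that are homogeneous of degree $d$. Let $C_0$ be a flat of $X$ and let $J_{C_0}$ be the set of flats containing $C_0$; as a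 set of flats of $X(a)$, it consists of the flats of $X(a)$ whose elements have a closure in $X$ that contains $C_0$ (if all $a_j\ge1$, these are the flats of $X(a)$ that contain all copies of the elements of $C_0$). Let $b\in\{0,1\}^m$ satisfy $b_i=1$ if and only if $H_i\supseteq C_0$. Then for all $d\in\mathbb N$ there is an isomorphism of $K$-vector spaces $$R^G_{(d,\;\mathfrak Ha-2e+b)}\;\cong\;\bigl(\ker I(X(a),-1,J_{C_0})\bigr)_d .$$ -/

import Mathlib

open scoped BigOperators

noncomputable section

namespace Zonotopal

/-! ### The matroid of a finite sequence of linear forms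

`X : ι → Module.Dual K V` is a finite sequence in `U = V^*`; a subsequence is a set of indices. -/

section Matroids

variable {K V ι : Type*} [Field K] [AddCommGroup V] [Module K V]

/-- The rank of a subsequence `Y` of `X`. -/
def rank (X : ι → Module.Dual K V) (Y : Set ι) : ℕ := Set.finrank K (X '' Y)

/-- The closure of a subsequence `Y` in `X`. -/
def closure (X : ι → Module.Dual K V) (Y : Set ι) : Set ι :=
  {i | rank X (insert i Y) = rank X Y}

/-- Flats are the closed subsequences. -/
def IsFlat (X : ι → Module.Dual K V) (C : Set ι) : Prop := closure X C = C

/-- Hyperplanes are the flats of rank `r - 1`, where `r = dim V`. -/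
def IsHyperplane (X : ι → Module.Dual K V) (H : Set ι) : Prop :=
  IsFlat X H ∧ rank X H + 1 = Module.finrank K V

/-- The set of all hyperplanes of `X`. -/
abbrev Hyperplane (X : ι → Module.Dual K V) : Type _ := {H : Set ι // IsHyperplane X H}

instance [Finite ι] (X : ι → Module.Dual K V) : Fintype (Hyperplane X) := Fintype.ofFinite _

/-- The flat `{x ∈ X : η(x) = 0}` defined by a vector `η ∈ V`. -/
def flatOf (X : ι → Module.Dual K V) (η : V) : Set ι := {i | X i η = 0}

/-- `η` is a defining normal for `C` if `C = {x ∈ X : η(x) = 0}`. -/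
def IsDefiningNormal (X : ι → Module.Dual K V) (C : Set ι) (η : V) : Prop := C = flatOf X η

open Classical in
/-- The non-containment hyperplane-vector matrix: the entry at `(H, i)` is `1` if `H` does not
contain `x_i`, and `0` otherwise. -/
def nonContainmentMatrix (X : ι → Module.Dual K V) : Matrix (Hyperplane X) ι ℤ :=
  Matrix.of fun H i => if i ∈ H.1 then 0 else 1

/-- The upper set of all flats of `X` that contain `C₀`. -/
def flatsAbove (X : ι → Module.Dual K V) (C₀ : Set ι) : Set (Set ι) := {C | IsFlat X C ∧ C₀ ⊆ C}

/-- The sequence `X(a)`, in which every `x_i` is replaced by `a_i` copies of itself. -/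
def replicate (X : ι → Module.Dual K V) (a : ι → ℕ) : (Σ i, Fin (a i)) → Module.Dual K V :=
  fun p => X p.1

/-- A set `J` of flats of `X`, read as a set of flats of `X(a)`: a flat of `X(a)` belongs to it
if the flat of `X` spanned by the same vectors belongs to `J`. -/
def replicateFlats (X : ι → Module.Dual K V) (a : ι → ℕ) (J : Set (Set ι)) :
    Set (Set (Σ i, Fin (a i))) :=
  {C | IsFlat (replicate X a) C ∧ closure X (Sigma.fst '' C) ∈ J}

end Matroids

/-! ### Symmetric algebras, differential operators, kernels of ideals -/

section Algebra

variable {K V : Type*} [Field K] [AddCommGroup V] [Module K V]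

/-- Two derivations on `Sym(U)` that agree on `U` are equal. -/
theorem derivation_ext {U : Type*} [AddCommGroup U] [Module K U]
    {D₁ D₂ : Derivation K (SymmetricAlgebra K U) (SymmetricAlgebra K U)}
    (h : ∀ u, D₁ (SymmetricAlgebra.ι K U u) = D₂ (SymmetricAlgebra.ι K U u)) : D₁ = D₂ := by
  ext f
  induction f using SymmetricAlgebra.induction with
  | algebraMap c => simp
  | ι u => exact h u
  | mul f g hf hg => simp [hf, hg]
  | add f g hf hg => simp [hf, hg]

/-- The algebra homomorphism `f ↦ f + ε D_v f` from `Sym(U)` to its dual numbers. -/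
def dualNumberHom (v : V) : SymmetricAlgebra K (Module.Dual K V) →ₐ[K]
    TrivSqZeroExt (SymmetricAlgebra K (Module.Dual K V))
      (SymmetricAlgebra K (Module.Dual K V)) :=
  SymmetricAlgebra.lift
    ((TrivSqZeroExt.inlAlgHom K (SymmetricAlgebra K (Module.Dual K V))
        (SymmetricAlgebra K (Module.Dual K V))).toLinearMap ∘ₗ
        SymmetricAlgebra.ι K (Module.Dual K V) +
      (TrivSqZeroExt.inrHom (SymmetricAlgebra K (Module.Dual K V))
        (SymmetricAlgebra K (Module.Dual K V))).restrictScalars K ∘ₗ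
        Algebra.linearMap K (SymmetricAlgebra K (Module.Dual K V)) ∘ₗ
        Module.Dual.eval K V v)

theorem fst_dualNumberHom (v : V) (f : SymmetricAlgebra K (Module.Dual K V)) :
    (dualNumberHom v f).fst = f := by
  have h : (TrivSqZeroExt.fstHom K (SymmetricAlgebra K (Module.Dual K V))
      (SymmetricAlgebra K (Module.Dual K V))).comp (dualNumberHom v) = AlgHom.id K _ := by
    apply SymmetricAlgebra.algHom_ext
    ext u
    simp [dualNumberHom]
  exact DFunLike.congr_fun h f

/-- The directional derivative `D_v` on `Sym(U)`, i.e. the unique derivation that satisfies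
`D_v(u) = v(u)` for all `u ∈ U`. -/
def directionalDerivative (v : V) :
    Derivation K (SymmetricAlgebra K (Module.Dual K V))
      (SymmetricAlgebra K (Module.Dual K V)) :=
  Derivation.mk' ((TrivSqZeroExt.sndHom (SymmetricAlgebra K (Module.Dual K V))
      (SymmetricAlgebra K (Module.Dual K V))).restrictScalars K ∘ₗ
      (dualNumberHom v).toLinearMap) (by
    intro f g
    simp [fst_dualNumberHom, mul_comm])

@[simp]
theorem directionalDerivative_ι (v : V) (u : Module.Dual K V) :
    directionalDerivative v (SymmetricAlgebra.ι K (Module.Dual K V) u) =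
      algebraMap K _ (u v) := by
  simp [directionalDerivative, dualNumberHom, Algebra.algebraMap_eq_smul_one]

/-- `v ↦ D_v` as a linear map into the endomorphisms of `Sym(U)`. -/
def directionalDerivativeHom :
    V →ₗ[K] Module.End K (SymmetricAlgebra K (Module.Dual K V)) where
  toFun v := (directionalDerivative v).toLinearMap
  map_add' v w := by
    rw [← Derivation.coe_add_linearMap]
    exact congrArg _ (derivation_ext fun u => by simp)
  map_smul' c v := by
    rw [RingHom.id_apply, ← Derivation.coe_smul_linearMap]
    exact congrArg _ (derivation_ext fun u => by simp [Algebra.smul_def])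

theorem directionalDerivativeHom_comm (v w : V) :
    directionalDerivativeHom (K := K) v * directionalDerivativeHom w =
      directionalDerivativeHom w * directionalDerivativeHom v := by
  have h : ⁅directionalDerivative (K := K) v, directionalDerivative (K := K) w⁆ = 0 :=
    derivation_ext fun u => by simp [Derivation.commutator_apply]
  ext f
  have := DFunLike.congr_fun h f
  rw [Derivation.commutator_apply] at this
  simpa [sub_eq_zero, directionalDerivativeHom] using this

/-- `Sym(V)` acting on `Sym(U)` by differential operators: `v_1 ⋯ v_k` acts as
`f ↦ D_{v_1}(⋯ (D_{v_k} f))`. -/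
def differentialOperator :
    SymmetricAlgebra K V →ₐ[K] Module.End K (SymmetricAlgebra K (Module.Dual K V)) :=
  RingCon.liftₐ (TensorAlgebra.symRingCon K V)
    (TensorAlgebra.lift K (directionalDerivativeHom (K := K) (V := V))) (by
      refine RingCon.ringConGen_le.2 fun x y h => ?_
      induction h with | mul_comm x y
      rw [RingCon.ker_apply]
      simpa using directionalDerivativeHom_comm x y)

theorem differentialOperator_ι (v : V) (f : SymmetricAlgebra K (Module.Dual K V)) :
    differentialOperator (SymmetricAlgebra.ι K V v) f = directionalDerivative v f := by
  simp [differentialOperator, SymmetricAlgebra.ι, directionalDerivativeHom]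

/-- The pairing `⟨f, q⟩`: the degree zero component of `q · f`. -/
def pairing (f : SymmetricAlgebra K (Module.Dual K V)) (q : SymmetricAlgebra K V) : K :=
  SymmetricAlgebra.algebraMapInv (differentialOperator q f)

/-- The kernel (inverse system) of an ideal of `Sym(V)`. -/
def kernel (I : Ideal (SymmetricAlgebra K V)) :
    Submodule K (SymmetricAlgebra K (Module.Dual K V)) where
  carrier := {f | ∀ q ∈ I, pairing f q = 0}
  add_mem' {f g} hf hg q hq := by
    have h₁ := hf q hq
    have h₂ := hg q hq
    simp only [pairing] at h₁ h₂ ⊢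
    simp [h₁, h₂]
  zero_mem' q _ := by simp [pairing]
  smul_mem' c f hf q hq := by
    have h₁ := hf q hq
    simp only [pairing] at h₁ ⊢
    simp [h₁]

/-- The homogeneous component of degree `d` of `Sym(U)`: the span of the products of `d` elements
of `U`. -/
def symComponent (K U : Type*) [Field K] [AddCommGroup U] [Module K U] (d : ℕ) :
    Submodule K (SymmetricAlgebra K U) :=
  LinearMap.range (SymmetricAlgebra.ι K U) ^ d

/-- The hierarchical zonotopal power ideal `I(X, k, J)`, generated by the powers
`D_η ^ (m(η) + k + χ(η))` for `η ∈ V \ {0}`, where `m(η)` is the number of elements of `X` outside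
the flat defined by `η` and `χ` is the indicator function of `J`. Exponents are nonnegative if
`X` spans `U` and `k ≥ -1`; otherwise negative exponents are read as `0`. -/
def powerIdeal {ι : Type*} (X : ι → Module.Dual K V) (k : ℤ) (J : Set (Set ι)) :
    Ideal (SymmetricAlgebra K V) :=
  Ideal.span {q | ∃ η : V, η ≠ 0 ∧ q = SymmetricAlgebra.ι K V η ^
    (((flatOf X η)ᶜ.ncard : ℤ) + k + J.indicator 1 (flatOf X η)).toNat}

end Algebra

/-! ### The Cox-Nagata ring -/

section CoxNagata

variable {K V m : Type*} [Field K] [AddCommGroup V] [Module K V] [Fintype m]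

/-- The group `G ⊆ K^m` of linear relations `∑ λ_i D_i = 0` among the vectors `D_i ∈ V`. -/
def nagataGroup (K : Type*) {V m : Type*} [Field K] [AddCommGroup V] [Module K V] [Fintype m]
    (D : m → V) : Submodule K (m → K) :=
  LinearMap.ker (Fintype.linearCombination K D)

/-- The action of `c ∈ K^m` on the polynomial ring in the variables `s_i` (the left summand)
and `t_i` (the right summand): `s_i ↦ s_i` and `t_i ↦ t_i + c_i s_i`. -/
def nagataAction (c : m → K) : MvPolynomial (m ⊕ m) K →ₐ[K] MvPolynomial (m ⊕ m) K :=
  MvPolynomial.aeval (Sum.elim (fun i => MvPolynomial.X (Sum.inl i))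
    (fun i => MvPolynomial.X (Sum.inr i) + MvPolynomial.C (c i) * MvPolynomial.X (Sum.inl i)))

/-- The Cox-Nagata ring `R^G` of the `G`-invariant polynomials. -/
def coxNagataRing (K : Type*) {V m : Type*} [Field K] [AddCommGroup V] [Module K V] [Fintype m]
    (D : m → V) : Subalgebra K (MvPolynomial (m ⊕ m) K) where
  carrier := {f | ∀ c ∈ nagataGroup K D, nagataAction c f = f}
  mul_mem' hf hg c hc := by rw [map_mul, hf c hc, hg c hc]
  add_mem' hf hg c hc := by rw [map_add, hf c hc, hg c hc]
  algebraMap_mem' r c _ := AlgHom.commutes _ r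

open Classical in
/-- The `ℤ^{m+1}`-grading: `deg s_i = (0, e_i)` and `deg t_i = (1, e_i)`. -/
def coxDegree (m : Type*) : m ⊕ m → ℤ × (m → ℤ) :=
  Sum.elim (fun i => (0, Pi.single i 1)) (fun i => (1, Pi.single i 1))

/-- The homogeneous component `R^G_{(d, u)}` of the Cox-Nagata ring. -/
def coxNagataComponent (K : Type*) {V m : Type*} [Field K] [AddCommGroup V] [Module K V]
    [Fintype m] (D : m → V) (d : ℤ) (u : m → ℤ) : Submodule K (MvPolynomial (m ⊕ m) K) :=
  Subalgebra.toSubmodule (coxNagataRing K D) ⊓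
    MvPolynomial.weightedHomogeneousSubmodule K (coxDegree m) (d, u)

end CoxNagata

end Zonotopal

end

/-! Both sides are identified with one space: the `f` of degree `d` in `Sym(U)` killed by `D_H ^
(m(H) - 1 + b_H)` for every hyperplane `H`, where `m(H)` counts the entries of `X(a)` outside `H`
and a negative exponent means `0`.

Cox-Nagata side (`nonempty_coxNagataComponent_equiv`). With `u` fixed, setting `s_i = 1` loses
nothing: an element becomes a polynomial in the `t_i` of degree `d`, of degree at most `u_i` in
`t_i`, and invariant under translation by `G`. Since `G` is the kernel of `c ↦ ∑ c_i D_i`, and this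
map is onto because hyperplane normals span `V`, the invariant polynomials are the pullbacks of
polynomials on `V`. Differentiation in `t_i` becomes differentiation along `D_i`, so in
characteristic zero the bound on the `t_i`-degree says that `D_i ^ (u_i + 1)` kills `f`.

Inverse system side (`forall_hyperplane_pow_eq_zero_iff`). Nondegeneracy of the pairing turns the
kernel into one differential equation for each `η ≠ 0`, and the equations of the hyperplane normals
imply the others. Indeed, if `η` is no hyperplane normal, the forms vanishing on `η` have a common
kernel `W` of dimension at least 2. A degree bound on `W` (`eq_zero_of_card_lt_degree_add_finrank`,
proved by deletion and contraction) shows that a solution of degree `m(η) - 1` vanishes on `W`;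
lowering the degree by derivatives reduces everything to this case. -/

noncomputable section

namespace Zonotopal

/-! ### Differential calculus on `Sym(U)`: Euler's relation and iterated derivatives. -/

section SymmetricAlgebraCalculus

variable {K V : Type*} [Field K] [AddCommGroup V] [Module K V]

/-- The Euler derivation, which multiplies a homogeneous element of `Sym(U)` by its degree. -/
def euler (K V : Type*) [Field K] [AddCommGroup V] [Module K V] [FiniteDimensional K V] :
    Derivation K (SymmetricAlgebra K (Module.Dual K V)) (SymmetricAlgebra K (Module.Dual K V)) :=
  ∑ i, SymmetricAlgebra.ι K (Module.Dual K V) ((Module.finBasis K V).coord i) •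
    directionalDerivative (Module.finBasis K V i)

theorem euler_apply [FiniteDimensional K V] (f : SymmetricAlgebra K (Module.Dual K V)) :
    euler K V f = ∑ i, SymmetricAlgebra.ι K (Module.Dual K V) ((Module.finBasis K V).coord i) *
      directionalDerivative (Module.finBasis K V i) f := by
  have h := congrFun (map_sum (Derivation.coeFnAddMonoidHom (R := K)) (fun i =>
    SymmetricAlgebra.ι K (Module.Dual K V) ((Module.finBasis K V).coord i) •
      directionalDerivative (K := K) (Module.finBasis K V i)) Finset.univ) f
  rw [Finset.sum_apply] at h
  exact h

theorem euler_ι [FiniteDimensional K V] (u : Module.Dual K V) :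
    euler K V (SymmetricAlgebra.ι K _ u) = SymmetricAlgebra.ι K _ u := by
  have hu : u = ∑ i, u (Module.finBasis K V i) • (Module.finBasis K V).coord i :=
    ((Module.finBasis K V).sum_dual_apply_smul_coord u).symm
  conv_rhs => rw [hu, map_sum]
  rw [euler_apply]
  refine Finset.sum_congr rfl fun i _ => ?_
  rw [directionalDerivative_ι, map_smul, Algebra.smul_def, mul_comm]

theorem euler_of_mem_symComponent [FiniteDimensional K V] {d : ℕ} :
    ∀ {f : SymmetricAlgebra K (Module.Dual K V)}, f ∈ symComponent K (Module.Dual K V) d →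
      euler K V f = (d : K) • f := by
  unfold symComponent
  induction d with
  | zero =>
    intro f hf
    rw [pow_zero, Submodule.mem_one] at hf
    obtain ⟨c, rfl⟩ := hf
    simp
  | succ d ih =>
    intro f hf
    rw [pow_succ'] at hf
    induction hf using Submodule.mul_induction_on' with
    | mem_mul_mem m hm n hn =>
      obtain ⟨u, rfl⟩ := hm
      simp only [Derivation.leibniz, ih hn, euler_ι, smul_eq_mul, Nat.cast_add, Nat.cast_one,
        add_smul, one_smul, mul_smul_comm]
      rw [mul_comm n]
    | add x _ y _ hx hy => rw [map_add, hx, hy, smul_add]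

theorem directionalDerivative_mem_symComponent (v : V) {d : ℕ} :
    ∀ {f : SymmetricAlgebra K (Module.Dual K V)}, f ∈ symComponent K (Module.Dual K V) (d + 1) →
      directionalDerivative v f ∈ symComponent K (Module.Dual K V) d := by
  unfold symComponent
  induction d with
  | zero =>
    intro f hf
    rw [zero_add, pow_one] at hf
    obtain ⟨u, rfl⟩ := hf
    rw [directionalDerivative_ι, pow_zero]
    exact Submodule.mem_one.2 ⟨_, rfl⟩
  | succ d ih =>
    intro f hf
    rw [pow_succ'] at hf
    induction hf using Submodule.mul_induction_on' with
    | mem_mul_mem m hm n hn =>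
      obtain ⟨u, rfl⟩ := hm
      rw [Derivation.leibniz, directionalDerivative_ι, smul_eq_mul, smul_eq_mul, mul_comm n,
        ← Algebra.smul_def]
      refine Submodule.add_mem _ ?_ (Submodule.smul_mem _ _ hn)
      rw [pow_succ']
      exact Submodule.mul_mem_mul ⟨u, rfl⟩ (ih hn)
    | add x _ y _ hx hy => rw [map_add]; exact Submodule.add_mem _ hx hy

theorem directionalDerivative_symComponent_zero (v : V)
    {f : SymmetricAlgebra K (Module.Dual K V)} (hf : f ∈ symComponent K (Module.Dual K V) 0) :
    directionalDerivative v f = 0 := by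
  rw [symComponent, pow_zero] at hf
  obtain ⟨c, rfl⟩ := Submodule.mem_one.1 hf
  simp

/-- Euler's relation: an eigenvector of the Euler derivation for a nonzero eigenvalue vanishes
as soon as all its derivatives do. -/
theorem eq_zero_of_directionalDerivative_eq_zero [FiniteDimensional K V]
    {f : SymmetricAlgebra K (Module.Dual K V)} {c : K}
    (hc : c ≠ 0) (hf : euler K V f = c • f) (h : ∀ v : V, directionalDerivative v f = 0) :
    f = 0 := by
  have : c • f = 0 := by rw [← hf, euler_apply]; simp [h]
  exact (smul_eq_zero.1 this).resolve_left hc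

theorem directionalDerivativeHom_apply (v : V) (f : SymmetricAlgebra K (Module.Dual K V)) :
    directionalDerivativeHom v f = directionalDerivative v f := rfl

theorem differentialOperator_ι_pow (v : V) (e : ℕ) :
    differentialOperator (SymmetricAlgebra.ι K V v ^ e) =
      directionalDerivativeHom (K := K) v ^ e := by
  rw [map_pow]
  congr 1
  ext f
  exact differentialOperator_ι v f

theorem directionalDerivativeHom_pow_comm (v w : V) (e : ℕ)
    (f : SymmetricAlgebra K (Module.Dual K V)) :
    (directionalDerivativeHom (K := K) v ^ e) (directionalDerivative w f) =
      directionalDerivative w ((directionalDerivativeHom (K := K) v ^ e) f) := by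
  have h : Commute (directionalDerivativeHom (K := K) v ^ e) (directionalDerivativeHom w) :=
    (show Commute _ _ from directionalDerivativeHom_comm v w).pow_left e
  exact LinearMap.congr_fun h.eq f

theorem directionalDerivativeHom_pow_eq_zero_of_le {v : V} {e e' : ℕ} (h : e ≤ e')
    {f : SymmetricAlgebra K (Module.Dual K V)}
    (hf : (directionalDerivativeHom (K := K) v ^ e) f = 0) :
    (directionalDerivativeHom (K := K) v ^ e') f = 0 := by
  obtain ⟨k, rfl⟩ := Nat.exists_eq_add_of_le' h
  rw [pow_add, Module.End.mul_apply, hf, map_zero]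

theorem directionalDerivativeHom_pow_smul_eq_zero_iff {v : V} {c : K} (hc : c ≠ 0) (e : ℕ)
    (f : SymmetricAlgebra K (Module.Dual K V)) :
    (directionalDerivativeHom (K := K) (c • v) ^ e) f = 0 ↔
      (directionalDerivativeHom (K := K) v ^ e) f = 0 := by
  rw [map_smul, smul_pow, LinearMap.smul_apply, smul_eq_zero, or_iff_right (pow_ne_zero _ hc)]

theorem euler_directionalDerivative [FiniteDimensional K V] (v : V)
    (f : SymmetricAlgebra K (Module.Dual K V)) :
    euler K V (directionalDerivative v f) =
      directionalDerivative v (euler K V f) - directionalDerivative v f := by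
  have h : ⁅euler K V, directionalDerivative (K := K) v⁆ = -directionalDerivative v :=
    derivation_ext fun u => by simp [Derivation.commutator_apply, euler_ι]
  have := DFunLike.congr_fun h f
  rw [Derivation.commutator_apply, Derivation.neg_apply] at this
  linear_combination this

theorem euler_directionalDerivativeHom_pow [FiniteDimensional K V] (v : V) (e : ℕ)
    {f : SymmetricAlgebra K (Module.Dual K V)} {c : K} (hf : euler K V f = c • f) :
    euler K V ((directionalDerivativeHom (K := K) v ^ e) f) =
      (c - e) • (directionalDerivativeHom (K := K) v ^ e) f := by
  induction e with
  | zero => simpa using hf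
  | succ e ih =>
    rw [pow_succ', Module.End.mul_apply, directionalDerivativeHom_apply,
      euler_directionalDerivative, ih, Derivation.map_smul, Nat.cast_succ, ← sub_sub,
      sub_smul _ (1 : K),
      one_smul]

/-- Iterated Leibniz rule for a product with a linear factor. -/
theorem directionalDerivativeHom_pow_ι_mul (v : V) (y : Module.Dual K V) (k : ℕ)
    (g : SymmetricAlgebra K (Module.Dual K V)) :
    (directionalDerivativeHom (K := K) v ^ (k + 1)) (SymmetricAlgebra.ι K _ y * g) =
      SymmetricAlgebra.ι K _ y * (directionalDerivativeHom (K := K) v ^ (k + 1)) g +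
        ((k + 1 : K) * y v) • (directionalDerivativeHom (K := K) v ^ k) g := by
  induction k with
  | zero =>
    simp [directionalDerivativeHom_apply, Algebra.smul_def, mul_comm, add_comm]
  | succ k ih =>
    rw [pow_succ', Module.End.mul_apply, ih, map_add, map_smul, directionalDerivativeHom_apply,
      Derivation.leibniz, directionalDerivative_ι, ← directionalDerivativeHom_apply,
      ← Module.End.mul_apply, ← Module.End.mul_apply, ← pow_succ',
      ← pow_succ', smul_eq_mul, smul_eq_mul, mul_comm _ (algebraMap K _ _), ← Algebra.smul_def,
      add_assoc, ← add_smul]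
    push_cast
    congr 2
    ring

/-- Every Leibniz term puts at least `a` derivatives on `f` or at least `b` on `g`. The bound is not
sharp, but it suffices for local nilpotence. -/
theorem directionalDerivativeHom_pow_mul_eq_zero (v : V) (n : ℕ) : ∀ (a b : ℕ), a + b = n →
    ∀ f g : SymmetricAlgebra K (Module.Dual K V), (directionalDerivativeHom (K := K) v ^ a) f = 0 →
      (directionalDerivativeHom (K := K) v ^ b) g = 0 →
      (directionalDerivativeHom (K := K) v ^ n) (f * g) = 0 := by
  induction n with
  | zero =>
    intro a b h f g hf hg
    obtain rfl : a = 0 := by omega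
    have : f = 0 := by simpa using hf
    simp [this]
  | succ n ih =>
    intro a b h f g hf hg
    rw [pow_succ, Module.End.mul_apply, directionalDerivativeHom_apply, Derivation.leibniz, map_add,
      smul_eq_mul, smul_eq_mul]
    have h₁ : (directionalDerivativeHom (K := K) v ^ n) (f * directionalDerivative v g) = 0 := by
      rcases b with _ | b
      · have : g = 0 := by simpa using hg
        simp [this]
      · rw [pow_succ, Module.End.mul_apply] at hg
        exact ih a b (by omega) _ _ hf hg
    have h₂ : (directionalDerivativeHom (K := K) v ^ n) (g * directionalDerivative v f) = 0 := by
      rcases a with _ | a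
      · have : f = 0 := by simpa using hf
        simp [this]
      · rw [pow_succ, Module.End.mul_apply] at hf
        exact ih b a (by omega) _ _ hg hf
    rw [h₁, h₂, add_zero]

theorem exists_directionalDerivativeHom_pow_eq_zero (v : V)
    (f : SymmetricAlgebra K (Module.Dual K V)) :
    ∃ n, (directionalDerivativeHom (K := K) v ^ n) f = 0 := by
  induction f using SymmetricAlgebra.induction with
  | algebraMap c => exact ⟨1, by simp [directionalDerivativeHom_apply]⟩
  | ι u => exact ⟨2, by simp [pow_two, directionalDerivativeHom_apply]⟩
  | mul f g hf hg =>
    obtain ⟨a, ha⟩ := hf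
    obtain ⟨b, hb⟩ := hg
    exact ⟨a + b, directionalDerivativeHom_pow_mul_eq_zero v _ a b rfl f g ha hb⟩
  | add f g hf hg =>
    obtain ⟨a, ha⟩ := hf
    obtain ⟨b, hb⟩ := hg
    refine ⟨a + b, ?_⟩
    rw [map_add, directionalDerivativeHom_pow_eq_zero_of_le (Nat.le_add_right a b) ha,
      directionalDerivativeHom_pow_eq_zero_of_le (Nat.le_add_left b a) hb, add_zero]

variable [CharZero K]

/-- Multiplication with a linear form raises the degree in every direction in which the form
is not constant. -/
theorem directionalDerivativeHom_pow_eq_zero_of_ι_mul {v : V} {y : Module.Dual K V} (hy : y v ≠ 0)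
    {m : ℕ} {g : SymmetricAlgebra K (Module.Dual K V)}
    (h : (directionalDerivativeHom (K := K) v ^ (m + 1)) (SymmetricAlgebra.ι K _ y * g) = 0) :
    (directionalDerivativeHom (K := K) v ^ m) g = 0 := by
  classical
  have hex := exists_directionalDerivativeHom_pow_eq_zero v g
  by_contra hne
  -- `k = l + 1` is the nilpotency order of `D_v` on `g`. If it exceeded `m`, the Leibniz rule would
  -- give `D_v ^ (l + 1) (y g) = (l + 1) y(v) D_v ^ l g`, which is nonzero in characteristic zero.
  set k := Nat.find hex
  have hk : (directionalDerivativeHom (K := K) v ^ k) g = 0 := Nat.find_spec hex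
  have hmk : m < k := by
    by_contra hle
    exact hne (directionalDerivativeHom_pow_eq_zero_of_le (not_lt.1 hle) hk)
  obtain ⟨l, hl⟩ : ∃ l, k = l + 1 := ⟨k - 1, by omega⟩
  have hl' : (directionalDerivativeHom (K := K) v ^ l) g ≠ 0 := Nat.find_min hex (by omega)
  have h₁ := directionalDerivativeHom_pow_eq_zero_of_le (e' := l + 1) (by omega) h
  rw [directionalDerivativeHom_pow_ι_mul, ← hl, hk, mul_zero, zero_add, smul_eq_zero] at h₁
  exact h₁.elim (mul_ne_zero (by exact_mod_cast Nat.succ_ne_zero l) hy) hl'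

theorem eq_zero_of_ι_mul_eq_zero {y : Module.Dual K V} (hy : y ≠ 0)
    {g : SymmetricAlgebra K (Module.Dual K V)} (h : SymmetricAlgebra.ι K _ y * g = 0) : g = 0 := by
  obtain ⟨v, hv⟩ : ∃ v, y v ≠ 0 := by
    by_contra! hall
    exact hy (LinearMap.ext hall)
  simpa using directionalDerivativeHom_pow_eq_zero_of_ι_mul (m := 0) hv (by rw [h, map_zero])


end SymmetricAlgebraCalculus

/-! ### Restriction to subspaces and divisibility by a linear form. -/

section Pullback

variable {K V W : Type*} [Field K] [AddCommGroup V] [Module K V] [AddCommGroup W] [Module K W]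

/-- The pullback of polynomial functions along a linear map. -/
def pullback (f : W →ₗ[K] V) :
    SymmetricAlgebra K (Module.Dual K V) →ₐ[K] SymmetricAlgebra K (Module.Dual K W) :=
  SymmetricAlgebra.lift (SymmetricAlgebra.ι K (Module.Dual K W) ∘ₗ f.dualMap)

@[simp]
theorem pullback_ι (f : W →ₗ[K] V) (u : Module.Dual K V) :
    pullback f (SymmetricAlgebra.ι K _ u) = SymmetricAlgebra.ι K _ (u ∘ₗ f) := by
  simp [pullback, LinearMap.dualMap_def, Module.Dual.transpose_apply]

theorem pullback_directionalDerivative (f : W →ₗ[K] V) (w : W)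
    (h : SymmetricAlgebra K (Module.Dual K V)) :
    pullback f (directionalDerivative (f w) h) = directionalDerivative w (pullback f h) := by
  induction h using SymmetricAlgebra.induction with
  | algebraMap c => simp
  | ι u => simp
  | mul g h hg hh => simp [hg, hh]
  | add g h hg hh => simp [hg, hh]

theorem pullback_directionalDerivativeHom_pow (f : W →ₗ[K] V) (w : W) (e : ℕ)
    (h : SymmetricAlgebra K (Module.Dual K V)) :
    pullback f ((directionalDerivativeHom (K := K) (f w) ^ e) h) =
      (directionalDerivativeHom (K := K) w ^ e) (pullback f h) := by
  induction e generalizing h with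
  | zero => simp
  | succ e ih =>
    rw [pow_succ, pow_succ, Module.End.mul_apply, Module.End.mul_apply, ih,
      directionalDerivativeHom_apply, directionalDerivativeHom_apply,
      pullback_directionalDerivative]

theorem pullback_euler [FiniteDimensional K V] [FiniteDimensional K W] (f : W →ₗ[K] V)
    (h : SymmetricAlgebra K (Module.Dual K V)) :
    pullback f (euler K V h) = euler K W (pullback f h) := by
  induction h using SymmetricAlgebra.induction with
  | algebraMap c => simp
  | ι u => simp [euler_ι]
  | mul g h hg hh => simp [hg, hh]
  | add g h hg hh => simp [hg, hh]

/-- A polynomial function that vanishes on the kernel of a nonzero linear form `y` is divisible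
by `y`. -/
theorem ι_dvd_of_pullback_ker_eq_zero {y : Module.Dual K V} (hy : y ≠ 0)
    {h : SymmetricAlgebra K (Module.Dual K V)}
    (hh : pullback (LinearMap.ker y).subtype h = 0) : SymmetricAlgebra.ι K _ y ∣ h := by
  obtain ⟨w, hw⟩ : ∃ w, y w = 1 := (LinearMap.surjective hy) 1
  -- The projection onto `ker y` along `w`. Restricting to `ker y` and pulling back along `π` sends
  -- `u` to `u - u(w) y`, hence is the identity modulo `y`.
  let π : V →ₗ[K] LinearMap.ker y :=
    (LinearMap.id - y.smulRight w).codRestrict (LinearMap.ker y) (by simp [hw])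
  let I : Ideal (SymmetricAlgebra K (Module.Dual K V)) := Ideal.span {SymmetricAlgebra.ι K _ y}
  have key : (Ideal.Quotient.mkₐ K I).comp ((pullback π).comp (pullback (LinearMap.ker y).subtype)) =
      Ideal.Quotient.mkₐ K I := by
    apply SymmetricAlgebra.algHom_ext
    ext u
    have hu : (u ∘ₗ (LinearMap.ker y).subtype) ∘ₗ π = u - u w • y := by
      ext v
      change u (v - y v • w) = u v - u w * y v
      rw [map_sub, map_smul, smul_eq_mul, mul_comm]
    change Ideal.Quotient.mk I (pullback π (pullback _ (SymmetricAlgebra.ι K _ u))) =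
      Ideal.Quotient.mk I (SymmetricAlgebra.ι K _ u)
    rw [pullback_ι, pullback_ι, hu, Ideal.Quotient.mk_eq_mk_iff_sub_mem, map_sub, map_smul,
      sub_sub_cancel_left, Algebra.smul_def]
    exact I.neg_mem (I.mul_mem_left _ (Ideal.mem_span_singleton_self _))
  have h' := DFunLike.congr_fun key h
  simp only [AlgHom.comp_apply, hh, map_zero] at h'
  exact Ideal.mem_span_singleton.1 (Ideal.Quotient.eq_zero_iff_mem.1 h'.symm)

end Pullback

/-! ### The degree bound `n - r`, by deletion and contraction. -/

section DegreeBound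

/-- `η` spans the common kernel of those forms `Y i`, `i ∈ s`, that vanish on `η`; in other words,
`η` defines a hyperplane of the sequence if the sequence spans the dual space. -/
def IsHyperplaneNormal {K V κ : Type*} [Field K] [AddCommGroup V] [Module K V]
    (Y : κ → Module.Dual K V) (s : Set κ) (η : V) : Prop :=
  η ≠ 0 ∧ ∀ v, (∀ i ∈ s, Y i η = 0 → Y i v = 0) → v ∈ Submodule.span K {η}

open Classical in
/-- The kernel of the ideal generated by the powers `D_η ^ m(η)` of the hyperplane normals `η` of
a spanning sequence of `n` forms on an `r`-dimensional space has no homogeneous elements of degree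
larger than `n - r`. -/
theorem eq_zero_of_card_lt_degree_add_finrank {K κ : Type*} [Field K] [CharZero K] (s : Finset κ) :
    ∀ {V : Type*} [AddCommGroup V] [Module K V] [FiniteDimensional K V]
      (Y : κ → Module.Dual K V) (d : ℤ) (h : SymmetricAlgebra K (Module.Dual K V)),
      (∀ v, (∀ i ∈ s, Y i v = 0) → v = 0) → euler K V h = (d : K) • h →
      (∀ η, IsHyperplaneNormal Y s η →
        (directionalDerivativeHom (K := K) η ^ (s.filter fun i => Y i η ≠ 0).card) h = 0) →
      (s.card : ℤ) < d + Module.finrank K V → h = 0 := by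
  induction s using Finset.induction_on with
  | empty =>
    intro V _ _ _ Y d h hspan hh _ hd
    -- No forms span only the dual of the zero space; then `d > 0`, and Euler's relation applies.
    have hV : ∀ v : V, v = 0 := fun v => hspan v (by simp)
    have : Subsingleton V := ⟨fun v w => by rw [hV v, hV w]⟩
    rw [Module.finrank_zero_of_subsingleton] at hd
    simp only [Finset.card_empty, Nat.cast_zero, add_zero] at hd
    refine eq_zero_of_directionalDerivative_eq_zero (Int.cast_ne_zero.2 hd.ne') hh fun v => ?_
    rw [hV v, ← directionalDerivativeHom_apply, map_zero, LinearMap.zero_apply]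
  | insert i s his ih =>
    intro V _ _ _ Y d h hspan hh hn hd
    rw [Finset.card_insert_of_notMem his] at hd
    push_cast at hd
    have hmono : ∀ η, IsHyperplaneNormal Y s η →
        IsHyperplaneNormal Y ((insert i s : Finset κ) : Set κ) η :=
      fun η hη => ⟨hη.1, fun v hv => hη.2 v fun j hj => hv j (Finset.mem_insert_of_mem hj)⟩
    by_cases hi : Y i = 0
    · refine ih Y d h (fun v hv => hspan v ?_) hh (fun η hη => ?_) (by linarith)
      · intro j hj
        rcases Finset.mem_insert.1 hj with rfl | hj
        · simp [hi]
        · exact hv j hj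
      · simpa [Finset.filter_insert, hi] using hn η (hmono η hη)
    · let W := LinearMap.ker (Y i)
      have hW : Module.finrank K W + 1 = Module.finrank K V :=
        Module.Dual.finrank_ker_add_one_of_ne_zero hi
      -- Contraction: on `ker (Y i)` both the number of forms and the dimension drop by one, so the
      -- induction hypothesis kills the restriction of `h`.
      have hdvd : SymmetricAlgebra.ι K _ (Y i) ∣ h := by
        apply ι_dvd_of_pullback_ker_eq_zero hi
        refine ih (fun j => Y j ∘ₗ W.subtype) d _ ?_ ?_ ?_ ?_
        · intro v hv
          refine Subtype.ext (hspan v fun j hj => ?_)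
          rcases Finset.mem_insert.1 hj with rfl | hj
          · exact v.2
          · exact hv j hj
        · rw [← pullback_euler, hh, map_smul]
        · intro η hη
          have hηi : Y i η = 0 := η.2
          have hη' : IsHyperplaneNormal Y ((insert i s : Finset κ) : Set κ) (η : V) := by
            refine ⟨fun h0 => hη.1 (Subtype.ext h0), fun v hv => ?_⟩
            have hvW : v ∈ W := hv i (by simp) hηi
            have := hη.2 ⟨v, hvW⟩ fun j hj hjη => hv j (Finset.mem_insert_of_mem hj) hjη
            obtain ⟨c, hc⟩ := Submodule.mem_span_singleton.1 this
            exact Submodule.mem_span_singleton.2 ⟨c, congrArg Subtype.val hc⟩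
          have h₁ := hn η hη'
          rw [Finset.filter_insert, if_neg (not_not.2 hηi)] at h₁
          have h₂ := pullback_directionalDerivativeHom_pow W.subtype η
            (s.filter fun j => Y j η ≠ 0).card h
          rw [Submodule.subtype_apply, h₁, map_zero] at h₂
          exact h₂.symm
        · rw [← hW] at hd
          push_cast at hd
          linarith
      obtain ⟨g, rfl⟩ := hdvd
      suffices hg : g = 0 by rw [hg, mul_zero]
      -- Deletion: `g` has degree `d - 1`, and `m(η)` drops by one exactly when `Y i η ≠ 0`, which
      -- is when multiplication by `Y i` costs one derivative. Encoding the degree as an integer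
      -- Euler eigenvalue lets it pass to the quotient `g`, even when it becomes negative.
      by_cases hs : ∀ v, (∀ j ∈ s, Y j v = 0) → v = 0
      · refine ih Y (d - 1) g hs ?_ (fun η hη => ?_) (by linarith)
        · refine sub_eq_zero.1 (eq_zero_of_ι_mul_eq_zero hi ?_)
          rw [Derivation.leibniz, euler_ι, smul_eq_mul, smul_eq_mul, mul_comm g] at hh
          rw [mul_sub, mul_smul_comm, Int.cast_sub, Int.cast_one, sub_smul, one_smul, ← hh]
          ring
        · have h₁ := hn η (hmono η hη)
          by_cases hηi : Y i η = 0
          · rw [Finset.filter_insert, if_neg (not_not.2 hηi)] at h₁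
            refine eq_zero_of_ι_mul_eq_zero hi ?_
            rcases hm : (s.filter fun j => Y j η ≠ 0).card with _ | m
            · simpa [hm] using h₁
            · rw [hm, directionalDerivativeHom_pow_ι_mul, hηi] at h₁
              simpa using h₁
          · rw [Finset.filter_insert, if_pos hηi, Finset.card_insert_of_notMem (by simp [his])]
              at h₁
            exact directionalDerivativeHom_pow_eq_zero_of_ι_mul hηi h₁
      -- `Y i` is a coloop: some hyperplane normal `v` is met only by `Y i`, so the exponent is `1`
      -- and `D_v (Y i * g) = 0` forces `g = 0`.
      · push Not at hs
        obtain ⟨v, hv, hv0⟩ := hs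
        have hvi : Y i v ≠ 0 := fun h0 => hv0 <| hspan v fun j hj => by
          rcases Finset.mem_insert.1 hj with rfl | hj
          · exact h0
          · exact hv j hj
        have hnv : IsHyperplaneNormal Y ((insert i s : Finset κ) : Set κ) v := by
          refine ⟨hv0, fun w hw => Submodule.mem_span_singleton.2 ⟨Y i w / Y i v, ?_⟩⟩
          refine (sub_eq_zero.1 (hspan _ fun j hj => ?_)).symm
          rcases Finset.mem_insert.1 hj with rfl | hj'
          · simp [hvi]
          · simp [hv j hj', hw j (by simpa using hj) (hv j hj')]
        have h₁ := hn v hnv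
        rw [Finset.filter_insert, if_pos hvi, Finset.filter_false_of_mem (by simpa using hv)] at h₁
        simpa using directionalDerivativeHom_pow_eq_zero_of_ι_mul (m := 0) hvi (by simpa using h₁)

end DegreeBound

/-! ### Flats, hyperplanes and their normals. -/

section Flats

variable {K V ι : Type*} [Field K] [AddCommGroup V] [Module K V]

/-- The common kernel of the forms in a subsequence. -/
def zeroSpace (X : ι → Module.Dual K V) (C : Set ι) : Submodule K V :=
  (Submodule.span K (X '' C)).dualCoannihilator

theorem mem_zeroSpace {X : ι → Module.Dual K V} {C : Set ι} {v : V} :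
    v ∈ zeroSpace X C ↔ ∀ i ∈ C, X i v = 0 := by
  rw [zeroSpace, Submodule.mem_dualCoannihilator]
  refine ⟨fun h i hi => h _ (Submodule.subset_span ⟨i, hi, rfl⟩), fun h φ hφ => ?_⟩
  have : Submodule.span K (X '' C) ≤ LinearMap.ker (Module.Dual.eval K V v) := by
    rw [Submodule.span_le]
    rintro _ ⟨i, hi, rfl⟩
    exact h i hi
  exact this hφ

theorem eq_zero_of_span_eq_top {X : ι → Module.Dual K V}
    (hX : Submodule.span K (Set.range X) = ⊤) {v : V} (hv : ∀ i, X i v = 0) : v = 0 := by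
  have h : v ∈ zeroSpace X Set.univ := mem_zeroSpace.2 fun i _ => hv i
  rw [zeroSpace, Set.image_univ, hX, Submodule.mem_dualCoannihilator] at h
  exact (Module.forall_dual_apply_eq_zero_iff K v).1 fun φ => h φ trivial

theorem isHyperplaneNormal_univ_iff {X : ι → Module.Dual K V} {η : V} :
    IsHyperplaneNormal X Set.univ η ↔
      η ≠ 0 ∧ zeroSpace X (flatOf X η) = Submodule.span K {η} := by
  refine and_congr_right fun _ => ⟨fun h => le_antisymm (fun v hv => ?_) ?_, fun h v hv => ?_⟩
  · exact h v fun i _ hi => mem_zeroSpace.1 hv i hi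
  · rw [Submodule.span_singleton_le_iff_mem, mem_zeroSpace]
    exact fun i hi => hi
  · rw [← h, mem_zeroSpace]
    exact fun i hi => hv i trivial hi

/-- Hyperplane normals with the same zero set are proportional. -/
theorem IsHyperplaneNormal.exists_smul {X : ι → Module.Dual K V} {η ω : V}
    (hη : IsHyperplaneNormal X Set.univ η) (hω : ω ≠ 0) (h : flatOf X η ⊆ flatOf X ω) :
    ∃ c : K, c ≠ 0 ∧ ω = c • η := by
  obtain ⟨c, rfl⟩ := Submodule.mem_span_singleton.1 (hη.2 ω fun i _ hi => h hi)
  exact ⟨c, fun hc => hω (by rw [hc, zero_smul]), rfl⟩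

/-- Every proper flat is contained in a hyperplane; the normal of the hyperplane may be chosen
outside the kernel of a given form. -/
theorem exists_isHyperplaneNormal_flatOf_subset [Finite ι] {X : ι → Module.Dual K V}
    (hX : ∀ v, (∀ i, X i v = 0) → v = 0) {u : Module.Dual K V} {η : V} (hη : u η ≠ 0) :
    ∃ ω, IsHyperplaneNormal X Set.univ ω ∧ u ω ≠ 0 ∧ flatOf X η ⊆ flatOf X ω := by
  -- Maximize the flat of `ω` among vectors outside `ker u`. If `v` contradicts that `ω` is a
  -- normal, its correction `w` in `ker u` can be used to make one more form vanish on `ω` without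
  -- changing `u ω`.
  obtain ⟨F, ⟨⟨ω, hω, rfl⟩, hηω⟩, hmax⟩ := Set.Finite.exists_maximal
    (s := {F : Set ι | (∃ ω, u ω ≠ 0 ∧ F = flatOf X ω) ∧ flatOf X η ⊆ F}) (Set.toFinite _)
    ⟨_, ⟨η, hη, rfl⟩, subset_rfl⟩
  refine ⟨ω, ⟨fun h0 => hω (by rw [h0, map_zero]), fun v hv => ?_⟩, hω, hηω⟩
  by_contra hne
  obtain ⟨w, hw⟩ : ∃ w, w = v - (u v / u ω) • ω := ⟨_, rfl⟩
  have huw : u w = 0 := by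
    rw [hw, map_sub, map_smul, smul_eq_mul, div_mul_cancel₀ _ hω, sub_self]
  have hsub : ∀ j, X j ω = 0 → X j w = 0 := fun j hj => by
    rw [hw, map_sub, map_smul, hj, hv j trivial hj, smul_zero, sub_zero]
  obtain ⟨j, hj⟩ : ∃ j, X j w ≠ 0 := by
    by_contra! h
    exact hne (Submodule.mem_span_singleton.2 ⟨_, (sub_eq_zero.1 (hw.symm.trans (hX w h))).symm⟩)
  have hsub' : flatOf X ω ⊆ flatOf X (ω - (X j ω / X j w) • w) := fun i hi => by
    have hi : X i ω = 0 := hi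
    change X i _ = 0
    rw [map_sub, map_smul, hi, hsub i hi, smul_zero, sub_zero]
  refine hj (hsub j (hmax ⟨⟨_, ?_, rfl⟩, hηω.trans hsub'⟩ hsub' (?_ : X j _ = 0)))
  · rwa [map_sub, map_smul, huw, smul_zero, sub_zero]
  · rw [map_sub, map_smul, smul_eq_mul, div_mul_cancel₀ _ hj, sub_self]

variable [FiniteDimensional K V]

theorem rank_add_finrank_zeroSpace (X : ι → Module.Dual K V) (C : Set ι) :
    rank X C + Module.finrank K (zeroSpace X C) = Module.finrank K V :=
  Subspace.finrank_add_finrank_dualCoannihilator_eq _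

/-- Rank and dimension of the common kernel add up to `dim V`, so adding `x_i` keeps the rank
exactly when it keeps the common kernel. -/
theorem mem_closure_iff {X : ι → Module.Dual K V} {C : Set ι} {i : ι} :
    i ∈ closure X C ↔ ∀ v ∈ zeroSpace X C, X i v = 0 := by
  have hle : zeroSpace X (insert i C) ≤ zeroSpace X C := fun v hv =>
    mem_zeroSpace.2 fun j hj => mem_zeroSpace.1 hv j (Set.mem_insert_of_mem _ hj)
  have h₁ := rank_add_finrank_zeroSpace X C
  have h₂ := rank_add_finrank_zeroSpace X (insert i C)
  constructor
  · intro h v hv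
    have h : rank X (insert i C) = rank X C := h
    rw [← Submodule.eq_of_le_of_finrank_eq hle (by omega)] at hv
    exact mem_zeroSpace.1 hv i (Set.mem_insert _ _)
  · intro h
    have : zeroSpace X (insert i C) = zeroSpace X C := le_antisymm hle fun v hv =>
      mem_zeroSpace.2 fun j hj => by
        rcases hj with rfl | hj
        · exact h v hv
        · exact mem_zeroSpace.1 hv j hj
    rw [this] at h₂
    change rank X (insert i C) = rank X C
    omega

theorem subset_closure (X : ι → Module.Dual K V) (C : Set ι) : C ⊆ closure X C :=
  fun i hi => mem_closure_iff.2 fun _ hv => mem_zeroSpace.1 hv i hi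

theorem closure_subset_flatOf {X : ι → Module.Dual K V} {C : Set ι} {η : V}
    (h : C ⊆ flatOf X η) : closure X C ⊆ flatOf X η :=
  fun _ hi => mem_closure_iff.1 hi η (mem_zeroSpace.2 fun _ hj => h hj)

theorem isFlat_flatOf (X : ι → Module.Dual K V) (η : V) : IsFlat X (flatOf X η) :=
  (closure_subset_flatOf subset_rfl).antisymm (subset_closure X _)

theorem IsHyperplaneNormal.isHyperplane {X : ι → Module.Dual K V} {η : V}
    (h : IsHyperplaneNormal X Set.univ η) : IsHyperplane X (flatOf X η) := by
  refine ⟨isFlat_flatOf X η, ?_⟩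
  rw [isHyperplaneNormal_univ_iff] at h
  rw [← rank_add_finrank_zeroSpace X (flatOf X η), h.2, finrank_span_singleton h.1]

theorem IsHyperplane.isHyperplaneNormal {X : ι → Module.Dual K V}
    (hX : ∀ v, (∀ i, X i v = 0) → v = 0) {H : Set ι} (hH : IsHyperplane X H) {η : V}
    (hη : IsDefiningNormal X H η) : IsHyperplaneNormal X Set.univ η := by
  have hη : H = flatOf X η := hη
  subst hη
  have h₁ : Module.finrank K (zeroSpace X (flatOf X η)) = 1 := by
    have := rank_add_finrank_zeroSpace X (flatOf X η)
    have := hH.2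
    omega
  have h₀ : η ≠ 0 := by
    rintro rfl
    have : zeroSpace X (flatOf X (0 : V)) = ⊥ :=
      (Submodule.eq_bot_iff _).2 fun v hv => hX v fun i => mem_zeroSpace.1 hv i (map_zero _)
    rw [this, finrank_bot] at h₁
    exact zero_ne_one h₁
  refine isHyperplaneNormal_univ_iff.2 ⟨h₀, (Submodule.eq_of_le_of_finrank_eq ?_ ?_).symm⟩
  · rw [Submodule.span_singleton_le_iff_mem, mem_zeroSpace]
    exact fun i hi => hi
  · rw [h₁, finrank_span_singleton h₀]

/-- Up to scaling, every hyperplane normal is among the given ones. -/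
theorem IsHyperplaneNormal.exists_hyperplane {X : ι → Module.Dual K V}
    (hX : ∀ v, (∀ i, X i v = 0) → v = 0) {D : Hyperplane X → V}
    (hD : ∀ H, IsDefiningNormal X H.1 (D H)) {η : V} (hη : IsHyperplaneNormal X Set.univ η) :
    ∃ H : Hyperplane X, H.1 = flatOf X η ∧ ∃ c : K, c ≠ 0 ∧ D H = c • η :=
  ⟨⟨_, hη.isHyperplane⟩, rfl, hη.exists_smul
    (hη.isHyperplane.isHyperplaneNormal hX (hD ⟨_, hη.isHyperplane⟩)).1 (hD ⟨_, _⟩).subset⟩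

/-- The defining normals of the hyperplanes of a spanning sequence span `V`. -/
theorem span_range_normals_eq_top [Finite ι] {X : ι → Module.Dual K V}
    (hX : ∀ v, (∀ i, X i v = 0) → v = 0) {D : Hyperplane X → V}
    (hD : ∀ H, IsDefiningNormal X H.1 (D H)) : Submodule.span K (Set.range D) = ⊤ := by
  by_contra hne
  obtain ⟨u, hu, hle⟩ := Submodule.exists_le_ker_of_lt_top _ (lt_top_iff_ne_top.2 hne)
  obtain ⟨v, hv⟩ : ∃ v, u v ≠ 0 := by
    by_contra! h
    exact hu (LinearMap.ext h)
  obtain ⟨ω, hω, huω, -⟩ := exists_isHyperplaneNormal_flatOf_subset hX hv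
  obtain ⟨H, -, c, hc, hH⟩ := hω.exists_hyperplane hX hD
  have : u (D H) = 0 := hle (Submodule.subset_span ⟨H, rfl⟩)
  rw [hH, map_smul, smul_eq_mul] at this
  exact (mul_ne_zero hc huω) this

end Flats

/-! ### Inverse systems of power ideals as differential equations. -/

section Kernels

variable {K V : Type*} [Field K] [AddCommGroup V] [Module K V]

theorem directionalDerivativeHom_pow_mem_symComponent (v : V) {d : ℕ}
    {f : SymmetricAlgebra K (Module.Dual K V)} (hf : f ∈ symComponent K (Module.Dual K V) d)
    (e : ℕ) :
    (directionalDerivativeHom (K := K) v ^ e) f ∈ symComponent K (Module.Dual K V) (d - e) := by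
  induction e with
  | zero => exact hf
  | succ e ih =>
    rw [pow_succ', Module.End.mul_apply, directionalDerivativeHom_apply, ← Nat.sub_sub]
    rcases hk : d - e with _ | k
    · rw [hk] at ih
      rw [directionalDerivative_symComponent_zero v ih]
      exact Submodule.zero_mem _
    · rw [hk] at ih
      exact directionalDerivative_mem_symComponent v ih

theorem pairing_mul (f : SymmetricAlgebra K (Module.Dual K V)) (q p : SymmetricAlgebra K V) :
    pairing f (q * p) = pairing (differentialOperator p f) q := by
  rw [pairing, map_mul, Module.End.mul_apply, pairing]

variable [FiniteDimensional K V] [CharZero K]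

/-- In characteristic zero, the pairing is nondegenerate. -/
theorem eq_zero_of_pairing_eq_zero {d : ℕ} : ∀ {f : SymmetricAlgebra K (Module.Dual K V)},
    f ∈ symComponent K (Module.Dual K V) d → (∀ q, pairing f q = 0) → f = 0 := by
  induction d with
  | zero =>
    intro f hf h
    rw [symComponent, pow_zero] at hf
    obtain ⟨c, rfl⟩ := Submodule.mem_one.1 hf
    have := h 1
    rw [pairing, map_one, Module.End.one_apply, AlgHom.commutes] at this
    rw [show c = 0 from this, map_zero]
  | succ d ih =>
    intro f hf h
    refine eq_zero_of_directionalDerivative_eq_zero (c := ((d + 1 : ℕ) : K))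
      (Nat.cast_ne_zero.2 d.succ_ne_zero) (euler_of_mem_symComponent hf) fun v => ?_
    refine ih (directionalDerivative_mem_symComponent v hf) fun q => ?_
    rw [← differentialOperator_ι, ← pairing_mul]
    exact h _

/-- Pairing `f` with `q * D_η ^ e` is pairing `D_η ^ e f` with `q`; nondegeneracy then turns
orthogonality to the ideal into annihilation by its generators. -/
theorem mem_kernel_powerIdeal_iff {ι : Type*} (X : ι → Module.Dual K V) (k : ℤ) (J : Set (Set ι))
    {d : ℕ} {f : SymmetricAlgebra K (Module.Dual K V)}
    (hf : f ∈ symComponent K (Module.Dual K V) d) :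
    f ∈ kernel (powerIdeal X k J) ↔ ∀ η : V, η ≠ 0 → (directionalDerivativeHom (K := K) η ^
      (((flatOf X η)ᶜ.ncard : ℤ) + k + J.indicator 1 (flatOf X η)).toNat) f = 0 := by
  constructor
  · intro h η hη
    refine eq_zero_of_pairing_eq_zero (directionalDerivativeHom_pow_mem_symComponent η hf _)
      fun q => ?_
    rw [← differentialOperator_ι_pow, ← pairing_mul]
    exact h _ (Ideal.mul_mem_left _ q (Ideal.subset_span ⟨η, hη, rfl⟩))
  · intro h q hq
    suffices hq0 : differentialOperator q f = 0 by rw [pairing, hq0, map_zero]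
    refine Submodule.span_induction ?_ ?_ ?_ ?_ hq
    · rintro _ ⟨η, hη, rfl⟩
      rw [differentialOperator_ι_pow]
      exact h η hη
    · rw [map_zero, LinearMap.zero_apply]
    · intro p q _ _ hp hq
      rw [map_add, LinearMap.add_apply, hp, hq, add_zero]
    · intro p q _ hq
      rw [smul_eq_mul, map_mul, Module.End.mul_apply, hq, map_zero]

/-- If a polynomial is killed by the powers `D_ω ^ m(ω)` for all hyperplane normals `ω`, then it
is killed by the powers `D_η ^ (m(η) - 1)` for all other `η`. -/
theorem directionalDerivativeHom_pow_eq_zero_of_not_isHyperplaneNormal {κ : Type*} [Finite κ]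
    {Y : κ → Module.Dual K V} (hY : ∀ v, (∀ i, Y i v = 0) → v = 0) {η : V} (hη : η ≠ 0)
    (hnot : ¬ IsHyperplaneNormal Y Set.univ η) {d : ℕ} :
    ∀ {h : SymmetricAlgebra K (Module.Dual K V)}, h ∈ symComponent K (Module.Dual K V) d →
      (∀ ω, IsHyperplaneNormal Y Set.univ ω →
        (directionalDerivativeHom (K := K) ω ^ (flatOf Y ω)ᶜ.ncard) h = 0) →
      (directionalDerivativeHom (K := K) η ^ ((flatOf Y η)ᶜ.ncard - 1)) h = 0 := by
  classical
  have := Fintype.ofFinite κ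
  set M := (flatOf Y η)ᶜ.ncard - 1 with hM
  -- The hypotheses pass to derivatives of `h`, so by induction on the degree all derivatives of
  -- `D_η ^ M h` vanish. Euler's relation concludes unless `k = M`, when `D_η ^ M h` is a constant.
  have grad : ∀ {k : ℕ} {h : SymmetricAlgebra K (Module.Dual K V)},
      h ∈ symComponent K (Module.Dual K V) k →
      (∀ ω, IsHyperplaneNormal Y Set.univ ω →
        (directionalDerivativeHom (K := K) ω ^ (flatOf Y ω)ᶜ.ncard) h = 0) →
      (∀ v, (directionalDerivativeHom (K := K) η ^ M) (directionalDerivative v h) = 0) →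
      (directionalDerivativeHom (K := K) η ^ M) h = 0 := by
    intro k h hh hn hgrad
    by_cases hkM : k = M
    · let W := zeroSpace Y (flatOf Y η)
      have hηW : η ∈ W := mem_zeroSpace.2 fun i hi => hi
      have hlt : Submodule.span K {η} < W := by
        refine lt_of_le_of_ne ((Submodule.span_singleton_le_iff_mem _ _).2 hηW) fun heq => ?_
        exact hnot (isHyperplaneNormal_univ_iff.2 ⟨hη, heq.symm⟩)
      have hfin := Submodule.finrank_lt_finrank_of_lt hlt
      rw [finrank_span_singleton hη] at hfin
      let s : Finset κ := Finset.univ.filter fun i => Y i η ≠ 0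
      have hs : (flatOf Y η)ᶜ.ncard = s.card := by
        rw [← Set.ncard_coe_finset]
        congr 1
        ext i
        simp [s, flatOf]
      have hW : ∀ v : W, ∀ i, i ∉ s → Y i v = 0 := fun v i hi =>
        mem_zeroSpace.1 v.2 i (by simpa [s, flatOf] using hi)
      -- Only the `m(η)` forms indexed by `s` survive on `W`, and `m(η) < M + dim W` because `dim W
      -- ≥ 2`. Thus the degree bound applies.
      have hρ : pullback W.subtype h = 0 := by
        refine eq_zero_of_card_lt_degree_add_finrank s (fun i => Y i ∘ₗ W.subtype) k _ ?_ ?_ ?_ ?_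
        · intro v hv
          refine Subtype.ext (hY v fun i => ?_)
          by_cases hi : i ∈ s
          · exact hv i hi
          · exact hW v i hi
        · rw [← pullback_euler, euler_of_mem_symComponent hh, map_smul, Int.cast_natCast]
        · intro ω hω
          have hω' : IsHyperplaneNormal Y Set.univ (ω : V) := by
            refine ⟨fun h0 => hω.1 (Subtype.ext h0), fun v hv => ?_⟩
            have hvW : v ∈ W := mem_zeroSpace.2 fun i hi =>
              hv i trivial (hW ω i (by simpa [s, flatOf] using hi))
            obtain ⟨c, hc⟩ := Submodule.mem_span_singleton.1
              (hω.2 ⟨v, hvW⟩ fun i _ hi => hv i trivial hi)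
            exact Submodule.mem_span_singleton.2 ⟨c, congrArg Subtype.val hc⟩
          have hcard : (s.filter fun i => (Y i ∘ₗ W.subtype) ω ≠ 0).card =
              (flatOf Y (ω : V))ᶜ.ncard := by
            rw [← Set.ncard_coe_finset]
            congr 1
            ext i
            have := hW ω i
            simp only [Finset.coe_filter, Set.mem_ofPred_eq, Set.mem_compl_iff, flatOf]
            exact ⟨fun h => h.2, fun h => ⟨by_contra fun hi => h (this hi), h⟩⟩
          rw [hcard, ← pullback_directionalDerivativeHom_pow]
          exact (congrArg _ (hn ω hω')).trans (map_zero _)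
        · omega
      -- As `η ∈ W`, the constant `D_η ^ M h` can be computed from the restriction of `h` to `W`,
      -- which is zero.
      have hconst := directionalDerivativeHom_pow_mem_symComponent η hh M
      rw [hkM, Nat.sub_self, symComponent, pow_zero] at hconst
      obtain ⟨c, hc⟩ := Submodule.mem_one.1 hconst
      have h₁ := pullback_directionalDerivativeHom_pow W.subtype ⟨η, hηW⟩ M h
      rw [hρ, map_zero, Submodule.subtype_apply, ← hc, AlgHom.commutes,
        SymmetricAlgebra.algebraMap_eq_zero_iff] at h₁
      rw [← hc, h₁, map_zero]
    · refine eq_zero_of_directionalDerivative_eq_zero (c := (k : K) - M)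
        (sub_ne_zero.2 (Nat.cast_injective.ne hkM))
        (euler_directionalDerivativeHom_pow η M (euler_of_mem_symComponent hh)) fun v => ?_
      rw [← directionalDerivativeHom_pow_comm]
      exact hgrad v
  clear_value M
  induction d with
  | zero =>
    intro h hh hn
    refine grad hh hn fun v => ?_
    rw [directionalDerivative_symComponent_zero v hh, map_zero]
  | succ d ih =>
    intro h hh hn
    refine grad hh hn fun v => ?_
    refine ih (directionalDerivative_mem_symComponent v hh) fun ω hω => ?_
    rw [directionalDerivativeHom_pow_comm, hn ω hω, map_zero]

end Kernels

/-! ### Reduction of the power ideal of `X(a)` to hyperplane normals of `X`. -/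

section Replicate

variable {K V ι : Type*} [Field K] [AddCommGroup V] [Module K V] {X : ι → Module.Dual K V}
  {a : ι → ℕ}

theorem IsHyperplaneNormal.of_replicate {η : V}
    (h : IsHyperplaneNormal (replicate X a) Set.univ η) : IsHyperplaneNormal X Set.univ η :=
  ⟨h.1, fun v hv => h.2 v fun p _ hp => hv p.1 trivial hp⟩

variable [FiniteDimensional K V]

theorem subset_flatOf_of_mem_replicateFlats {C₀ : Set ι} {η : V}
    (h : flatOf (replicate X a) η ∈ replicateFlats X a (flatsAbove X C₀)) :
    C₀ ⊆ flatOf X η := by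
  refine h.2.2.trans (closure_subset_flatOf ?_)
  rintro _ ⟨p, hp, rfl⟩
  exact hp

/-- Some `a_j` may be `0`, so the closure in `X` of a flat of `X(a)` can be smaller than the flat of
`X` defined by the same vector. For a hyperplane normal of `X(a)` the common kernel is the line of
`η`, and the two agree. -/
theorem flatOf_mem_replicateFlats {C₀ : Set ι} {η : V}
    (hη : IsHyperplaneNormal (replicate X a) Set.univ η) (h : C₀ ⊆ flatOf X η) :
    flatOf (replicate X a) η ∈ replicateFlats X a (flatsAbove X C₀) := by
  have hcl : closure X (Sigma.fst '' flatOf (replicate X a) η) = flatOf X η := by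
    refine (closure_subset_flatOf ?_).antisymm fun i hi => mem_closure_iff.2 fun v hv => ?_
    · rintro _ ⟨p, hp, rfl⟩
      exact hp
    · obtain ⟨c, rfl⟩ := Submodule.mem_span_singleton.1
        (hη.2 v fun p _ hp => mem_zeroSpace.1 hv p.1 ⟨p, hp, rfl⟩)
      have hi : X i η = 0 := hi
      rw [map_smul, hi, smul_zero]
  refine ⟨isFlat_flatOf _ η, ?_⟩
  rw [hcl]
  exact ⟨isFlat_flatOf X η, h⟩

variable [CharZero K] [Finite ι]

/-- The kernel of the semi-internal power ideal is already cut out by the powers of the defining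
normals of the hyperplanes. -/
theorem forall_hyperplane_pow_eq_zero_iff (hX : ∀ v, (∀ i, X i v = 0) → v = 0)
    {D : Hyperplane X → V} (hD : ∀ H, IsDefiningNormal X H.1 (D H)) {C₀ : Set ι}
    {b : Hyperplane X → ℤ} (hb : ∀ H, b H = 0 ∨ b H = 1) (hbC₀ : ∀ H, b H = 1 ↔ C₀ ⊆ H.1)
    {d : ℕ} {f : SymmetricAlgebra K (Module.Dual K V)}
    (hf : f ∈ symComponent K (Module.Dual K V) d) :
    (∀ H, (directionalDerivativeHom (K := K) (D H) ^
      (((flatOf (replicate X a) (D H))ᶜ.ncard : ℤ) - 1 + b H).toNat) f = 0) ↔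
    ∀ η : V, η ≠ 0 → (directionalDerivativeHom (K := K) η ^
      (((flatOf (replicate X a) η)ᶜ.ncard : ℤ) + -1 +
        (replicateFlats X a (flatsAbove X C₀)).indicator 1 (flatOf (replicate X a) η)).toNat) f
          = 0 := by
  classical
  have hind : ∀ η, (replicateFlats X a (flatsAbove X C₀)).indicator (1 : Set (Σ i, Fin (a i)) → ℤ)
      (flatOf (replicate X a) η) =
        if flatOf (replicate X a) η ∈ replicateFlats X a (flatsAbove X C₀) then 1 else 0 :=
    fun η => by rw [Set.indicator_apply, Pi.one_apply]
  constructor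
  · intro h
    have hflat : ∀ (η : V) (c : K), c ≠ 0 → flatOf (replicate X a) (c • η) =
        flatOf (replicate X a) η := fun η c hc => by
      ext p
      simp [flatOf, hc]
    have hnormal : ∀ ω, IsHyperplaneNormal X Set.univ ω → ∃ β : ℤ, (β = 0 ∨ β = 1) ∧
        (β = 1 → C₀ ⊆ flatOf X ω) ∧ (directionalDerivativeHom (K := K) ω ^
          (((flatOf (replicate X a) ω)ᶜ.ncard : ℤ) - 1 + β).toNat) f = 0 := by
      intro ω hω
      obtain ⟨H, hH, c, hc, hDH⟩ := hω.exists_hyperplane hX hD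
      refine ⟨b H, hb H, fun h1 => hH ▸ (hbC₀ H).1 h1, ?_⟩
      have := h H
      rwa [hDH, hflat _ _ hc, directionalDerivativeHom_pow_smul_eq_zero_iff hc] at this
    intro η hη
    by_cases hspan : ∀ v, (∀ p, replicate X a p v = 0) → v = 0
    · by_cases hηn : IsHyperplaneNormal (replicate X a) Set.univ η
      · obtain ⟨β, hβ, hβC₀, hfη⟩ := hnormal η hηn.of_replicate
        refine directionalDerivativeHom_pow_eq_zero_of_le ?_ hfη
        rw [hind]
        rcases hβ with rfl | rfl
        · split_ifs <;> omega
        · rw [if_pos (flatOf_mem_replicateFlats hηn (hβC₀ rfl))]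
          omega
      -- For other `η` the exponent `m(η) - 1` already suffices, whatever the indicator; the input
      -- needs only exponents `m(ω)` at normals, which holds as `β ≤ 1`.
      · refine directionalDerivativeHom_pow_eq_zero_of_le ?_
          (directionalDerivativeHom_pow_eq_zero_of_not_isHyperplaneNormal hspan hη hηn hf
            fun ω hω => ?_)
        · rw [hind]
          split_ifs <;> omega
        · obtain ⟨β, hβ, -, hfω⟩ := hnormal ω hω.of_replicate
          exact directionalDerivativeHom_pow_eq_zero_of_le (by omega) hfω
    -- If `X(a)` does not span, some hyperplane of `X` contains every entry of `X(a)`. Its exponent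
    -- `-1 + β` truncates to `0`, which forces `f = 0`.
    · push Not at hspan
      obtain ⟨v, hv, hv0⟩ := hspan
      obtain ⟨u, hu⟩ : ∃ u : Module.Dual K V, u v ≠ 0 := by
        by_contra! hall
        exact hv0 ((Module.forall_dual_apply_eq_zero_iff K v).1 hall)
      obtain ⟨ω, hω, -, hvω⟩ := exists_isHyperplaneNormal_flatOf_subset hX hu
      obtain ⟨β, hβ, -, hfω⟩ := hnormal ω hω
      have huniv : flatOf (replicate X a) ω = Set.univ :=
        Set.eq_univ_of_forall fun p => hvω (hv p)
      rw [huniv, Set.compl_univ, Set.ncard_empty, show (((0 : ℕ) : ℤ) - 1 + β).toNat = 0 by omega,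
        pow_zero, Module.End.one_apply] at hfω
      rw [hfω, map_zero]
  · intro h H
    refine directionalDerivativeHom_pow_eq_zero_of_le ?_
      (h (D H) (H.2.isHyperplaneNormal hX (hD H)).1)
    have hH : H.1 = flatOf X (D H) := hD H
    rw [hind]
    have := hb H
    split_ifs with hmem
    · have := (hbC₀ H).2 (hH ▸ subset_flatOf_of_mem_replicateFlats hmem)
      omega
    · omega

end Replicate

theorem nonContainmentMatrix_mulVec {K V ι : Type*} [Field K] [AddCommGroup V] [Module K V]
    [Fintype ι] {X : ι → Module.Dual K V} (a : ι → ℕ) {H : Hyperplane X} {η : V}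
    (hη : IsDefiningNormal X H.1 η) :
    (nonContainmentMatrix X).mulVec (fun i => (a i : ℤ)) H =
      ((flatOf (replicate X a) η)ᶜ.ncard : ℤ) := by
  classical
  have hη : H.1 = flatOf X η := hη
  have hset : (flatOf (replicate X a) η)ᶜ =
      ((Finset.univ.filter fun i => i ∉ H.1).sigma fun i => (Finset.univ : Finset (Fin (a i)))
        : Finset (Σ i, Fin (a i))) := by
    ext p
    simp [hη, flatOf, replicate]
  rw [hset, Set.ncard_coe_finset, Finset.card_sigma, Matrix.mulVec, dotProduct]
  simp [nonContainmentMatrix, Finset.sum_filter, ite_not]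

/-! ### Setting `s_i = 1` and recovering the `s_i` from the multidegree. -/

section Dehomogenization

variable {K m : Type*} [Field K]

/-- The specialization of a polynomial in the variables `s_i`, `t_i` at `s_i = 1`. -/
def dehomogenize (K m : Type*) [Field K] : MvPolynomial (m ⊕ m) K →ₐ[K] MvPolynomial m K :=
  MvPolynomial.aeval (Sum.elim 1 MvPolynomial.X)

/-- The translation `X_i ↦ X_i + c_i`. -/
def translate (c : m → K) : MvPolynomial m K →ₐ[K] MvPolynomial m K :=
  MvPolynomial.aeval fun i => MvPolynomial.X i + MvPolynomial.C (c i)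

theorem dehomogenize_nagataAction (c : m → K) (f : MvPolynomial (m ⊕ m) K) :
    dehomogenize K m (nagataAction c f) = translate c (dehomogenize K m f) := by
  suffices h : (dehomogenize K m).comp (nagataAction c) =
      (translate c).comp (dehomogenize K m) from DFunLike.congr_fun h f
  apply MvPolynomial.algHom_ext
  rintro (i | i) <;> simp [dehomogenize, nagataAction, translate, MvPolynomial.algebraMap_eq]

/-- The coarser grading `deg s_i = deg t_i = e_i`. -/
def coarseDegree (m : Type*) (j : m ⊕ m) : m → ℤ := (coxDegree m j).2

/-- The substitution `t_i ↦ t_i + c_i s_i` mixes the degrees `(1, e_i)` and `(0, e_i)`, so only the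
coarse grading is preserved; that grading is enough to invert dehomogenization. -/
theorem isWeightedHomogeneous_nagataAction (c : m → K) {w : m → ℤ}
    {f : MvPolynomial (m ⊕ m) K} (hf : MvPolynomial.IsWeightedHomogeneous (coarseDegree m) f w) :
    MvPolynomial.IsWeightedHomogeneous (coarseDegree m) (nagataAction c f) w := by
  have hvar : ∀ i, MvPolynomial.IsWeightedHomogeneous (coarseDegree m)
      (nagataAction c (MvPolynomial.X i)) (coarseDegree m i) := by
    have hX := MvPolynomial.isWeightedHomogeneous_X K (coarseDegree m)
    rintro (i | i)
    · simpa [nagataAction] using hX (Sum.inl i)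
    · simpa [nagataAction] using (hX (Sum.inr i)).add ((hX (Sum.inl i)).C_mul (c i))
  induction hf using MvPolynomial.IsWeightedHomogeneous.induction_on with
  | zero => rw [map_zero]; exact MvPolynomial.isWeightedHomogeneous_zero _ _ _
  | add p q _ _ hp hq => rw [map_add]; exact hp.add hq
  | monomial k r hk =>
    rw [MvPolynomial.monomial_eq, map_mul, Finsupp.prod, map_prod, ← MvPolynomial.algebraMap_eq,
      AlgHom.commutes, MvPolynomial.algebraMap_eq]
    rw [Finsupp.weight_apply, Finsupp.sum] at hk
    rw [← hk]
    refine MvPolynomial.IsWeightedHomogeneous.C_mul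
      (MvPolynomial.IsWeightedHomogeneous.prod _ _ _ fun i _ => ?_) r
    rw [map_pow]
    exact (hvar i).pow (k i)

variable [Fintype m]

/-- The exponent vector of the monomial `∏ s_i ^ (u_i - k_i) t_i ^ k_i`. -/
def homogenizeExponent (u : m → ℤ) (k : m →₀ ℕ) : m ⊕ m →₀ ℕ :=
  Finsupp.equivFunOnFinite.symm (Sum.elim (fun i => (u i - k i).toNat) k)

/-- The linear map `∏ t_i ^ k_i ↦ ∏ s_i ^ (u_i - k_i) t_i ^ k_i`. -/
def homogenize (K : Type*) {m : Type*} [Field K] [Fintype m] (u : m → ℤ) :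
    MvPolynomial m K →ₗ[K] MvPolynomial (m ⊕ m) K :=
  (MvPolynomial.basisMonomials m K).constr K fun k => MvPolynomial.monomial (homogenizeExponent u k) 1

theorem homogenize_monomial (u : m → ℤ) (k : m →₀ ℕ) (c : K) :
    homogenize K u (MvPolynomial.monomial k c) =
      MvPolynomial.monomial (homogenizeExponent u k) c := by
  have h : homogenize K u (MvPolynomial.monomial k 1) =
      MvPolynomial.monomial (homogenizeExponent u k) 1 :=
    (MvPolynomial.basisMonomials m K).constr_basis K _ k
  have hc : ∀ {σ : Type _} (l : σ →₀ ℕ), MvPolynomial.monomial l c =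
      c • MvPolynomial.monomial l (1 : K) := fun l => by
    rw [MvPolynomial.smul_monomial, smul_eq_mul, mul_one]
  rw [hc, map_smul, h, MvPolynomial.smul_monomial, smul_eq_mul, mul_one]

theorem dehomogenize_monomial (k : m ⊕ m →₀ ℕ) (c : K) :
    dehomogenize K m (MvPolynomial.monomial k c) =
      MvPolynomial.monomial (Finsupp.equivFunOnFinite.symm fun i => k (Sum.inr i)) c := by
  rw [dehomogenize, MvPolynomial.aeval_monomial, MvPolynomial.monomial_eq,
    Finsupp.prod_fintype _ _ (by simp), Finsupp.prod_fintype _ _ (by simp), Fintype.prod_sum_type]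
  simp [MvPolynomial.algebraMap_eq]

theorem dehomogenize_homogenize (u : m → ℤ) (g : MvPolynomial m K) :
    dehomogenize K m (homogenize K u g) = g := by
  induction g using MvPolynomial.induction_on' with
  | monomial k c =>
    rw [homogenize_monomial, dehomogenize_monomial]
    congr 2
    ext i
    simp [homogenizeExponent]
  | add p q hp hq => rw [map_add, map_add, hp, hq]

theorem weight_coxDegree_eq_iff {k : m ⊕ m →₀ ℕ} {d : ℤ} {u : m → ℤ} :
    Finsupp.weight (coxDegree m) k = (d, u) ↔
      (∑ i, (k (Sum.inr i) : ℤ)) = d ∧ ∀ i, (k (Sum.inl i) + k (Sum.inr i) : ℤ) = u i := by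
  classical
  rw [Finsupp.weight_apply, Finsupp.sum_fintype _ _ (by simp), Fintype.sum_sum_type, Prod.ext_iff,
    funext_iff]
  simp [coxDegree, Prod.fst_sum, Prod.snd_sum, Finset.sum_apply, Pi.single_apply]

theorem weight_coarseDegree_eq_iff {k : m ⊕ m →₀ ℕ} {u : m → ℤ} :
    Finsupp.weight (coarseDegree m) k = u ↔
      ∀ i, (k (Sum.inl i) + k (Sum.inr i) : ℤ) = u i := by
  classical
  rw [Finsupp.weight_apply, Finsupp.sum_fintype _ _ (by simp), Fintype.sum_sum_type, funext_iff]
  simp [coarseDegree, coxDegree, Finset.sum_apply, Pi.single_apply]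

theorem isWeightedHomogeneous_coarseDegree {d : ℤ} {u : m → ℤ} {f : MvPolynomial (m ⊕ m) K}
    (hf : MvPolynomial.IsWeightedHomogeneous (coxDegree m) f (d, u)) :
    MvPolynomial.IsWeightedHomogeneous (coarseDegree m) f u :=
  fun _ hk => weight_coarseDegree_eq_iff.2 (weight_coxDegree_eq_iff.1 (hf hk)).2

theorem homogenize_dehomogenize {u : m → ℤ} {f : MvPolynomial (m ⊕ m) K}
    (hf : MvPolynomial.IsWeightedHomogeneous (coarseDegree m) f u) :
    homogenize K u (dehomogenize K m f) = f := by
  induction hf using MvPolynomial.IsWeightedHomogeneous.induction_on with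
  | zero => simp
  | add p q _ _ hp hq => rw [map_add, map_add, hp, hq]
  | monomial k c hk =>
    rw [dehomogenize_monomial, homogenize_monomial]
    have hexp : homogenizeExponent u (Finsupp.equivFunOnFinite.symm fun i => k (Sum.inr i)) = k := by
      ext i
      have := weight_coarseDegree_eq_iff.1 hk
      rcases i with i | i
      · have := this i
        simp only [homogenizeExponent, Finsupp.equivFunOnFinite_symm_apply_apply, Sum.elim_inl]
        omega
      · simp [homogenizeExponent]
    rw [hexp]

theorem isWeightedHomogeneous_homogenize {d : ℕ} {u : m → ℤ} {g : MvPolynomial m K}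
    (hg : ∀ k ∈ g.support, k.degree = d ∧ ∀ i, k i < (u i + 1).toNat) :
    MvPolynomial.IsWeightedHomogeneous (coxDegree m) (homogenize K u g) ((d : ℤ), u) := by
  rw [g.as_sum, map_sum]
  refine MvPolynomial.IsWeightedHomogeneous.sum _ _ _ fun k hk => ?_
  rw [homogenize_monomial]
  refine MvPolynomial.isWeightedHomogeneous_monomial _ _ _ (weight_coxDegree_eq_iff.2 ?_)
  obtain ⟨h₁, h₂⟩ := hg k hk
  refine ⟨?_, fun i => ?_⟩
  · rw [← h₁, Finsupp.degree_eq_sum]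
    simp [homogenizeExponent]
  · have := h₂ i
    simp only [homogenizeExponent, Finsupp.equivFunOnFinite_symm_apply_apply, Sum.elim_inl,
      Sum.elim_inr]
    omega

theorem support_dehomogenize {d : ℕ} {u : m → ℤ} {f : MvPolynomial (m ⊕ m) K}
    (hf : MvPolynomial.IsWeightedHomogeneous (coxDegree m) f ((d : ℤ), u)) :
    ∀ k ∈ (dehomogenize K m f).support, k.degree = d ∧ ∀ i, k i < (u i + 1).toNat := by
  classical
  intro k hk
  rw [f.as_sum, map_sum] at hk
  obtain ⟨l, hl, hkl⟩ := Finset.mem_biUnion.1 (MvPolynomial.support_sum hk)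
  rw [dehomogenize_monomial] at hkl
  obtain rfl := Finset.mem_singleton.1 (MvPolynomial.support_monomial_subset hkl)
  obtain ⟨h₁, h₂⟩ := weight_coxDegree_eq_iff.1 (hf (MvPolynomial.mem_support_iff.1 hl))
  refine ⟨?_, fun i => ?_⟩
  · rw [Finsupp.degree_eq_sum]
    exact_mod_cast h₁
  · have := h₂ i
    simp only [Finsupp.equivFunOnFinite_symm_apply_apply]
    omega

end Dehomogenization

/-- In characteristic zero, differentiation lowers exponents without cancelling any monomial that
contains the variable. -/
theorem iterate_pderiv_eq_zero_iff {K m : Type*} [Field K] [CharZero K] (i : m) (e : ℕ) :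
    ∀ g : MvPolynomial m K, (MvPolynomial.pderiv i)^[e] g = 0 ↔ ∀ k ∈ g.support, k i < e := by
  induction e with
  | zero =>
    intro g
    simp [MvPolynomial.ext_iff]
  | succ e ih =>
    intro g
    rw [Function.iterate_succ_apply, ih]
    have hmem : ∀ k, k ∈ (MvPolynomial.pderiv i g).support ↔ k + Finsupp.single i 1 ∈ g.support := by
      intro k
      rw [MvPolynomial.mem_support_iff, MvPolynomial.mem_support_iff, MvPolynomial.coeff_pderiv,
        mul_ne_zero_iff, and_iff_left (by exact_mod_cast (k i).succ_ne_zero)]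
    constructor
    · intro h k hk
      rcases Nat.eq_zero_or_pos (k i) with h0 | h0
      · omega
      · have hle : Finsupp.single i 1 ≤ k := Finsupp.single_le_iff.2 h0
        have := h (k - Finsupp.single i 1) ((hmem _).2 (by rwa [tsub_add_cancel_of_le hle]))
        rw [Finsupp.tsub_apply, Finsupp.single_eq_same] at this
        omega
    · intro h k hk
      have := h _ ((hmem k).1 hk)
      rw [Finsupp.add_apply, Finsupp.single_eq_same] at this
      omega

/-! ### Translation-invariant polynomials as pullbacks from `V`. -/

section LinearSubstitution

variable {K V m : Type*} [Field K] [AddCommGroup V] [Module K V]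

/-- The pullback of polynomial functions along a linear map `V → K^m`. -/
def pullbackCoordinates (σ : V →ₗ[K] m → K) :
    MvPolynomial m K →ₐ[K] SymmetricAlgebra K (Module.Dual K V) :=
  MvPolynomial.aeval fun i => SymmetricAlgebra.ι K _ (LinearMap.proj i ∘ₗ σ)

theorem pullbackCoordinates_mem_symComponent (σ : V →ₗ[K] m → K) {d : ℕ} {g : MvPolynomial m K}
    (hg : ∀ k ∈ g.support, k.degree = d) :
    pullbackCoordinates σ g ∈ symComponent K (Module.Dual K V) d := by
  classical
  rw [g.as_sum, map_sum]
  refine Submodule.sum_mem _ fun k hk => ?_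
  rw [pullbackCoordinates, MvPolynomial.aeval_monomial, ← Algebra.smul_def, ← hg k hk,
    Finsupp.degree_apply, Finsupp.prod]
  refine Submodule.smul_mem _ _ ?_
  unfold symComponent
  induction k.support using Finset.induction_on with
  | empty => simp
  | insert i s hi ih =>
    rw [Finset.prod_insert hi, Finset.sum_insert hi, pow_add]
    exact Submodule.mul_mem_mul (Submodule.pow_mem_pow _ (LinearMap.mem_range_self _ _) _) ih

variable [Fintype m] (D : m → V)

/-- The pullback of polynomial functions along the map `c ↦ ∑ c_i D_i`. -/
def pullbackCombination : SymmetricAlgebra K (Module.Dual K V) →ₐ[K] MvPolynomial m K :=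
  SymmetricAlgebra.lift
    (∑ i, (Module.Dual.eval K V (D i)).smulRight (MvPolynomial.X (R := K) i))

@[simp]
theorem pullbackCombination_ι (y : Module.Dual K V) :
    pullbackCombination D (SymmetricAlgebra.ι K _ y) =
      ∑ i, y (D i) • (MvPolynomial.X i : MvPolynomial m K) := by
  simp [pullbackCombination]

variable {D}

theorem pullbackCombination_directionalDerivative (i : m)
    (h : SymmetricAlgebra K (Module.Dual K V)) :
    pullbackCombination D (directionalDerivative (D i) h) =
      MvPolynomial.pderiv i (pullbackCombination D h) := by
  classical
  induction h using SymmetricAlgebra.induction with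
  | algebraMap c => simp [MvPolynomial.algebraMap_eq]
  | ι y => simp [MvPolynomial.pderiv_X, Pi.single_apply, Algebra.algebraMap_eq_smul_one]
  | mul g h hg hh => simp [hg, hh]
  | add g h hg hh => simp [hg, hh]

theorem pullbackCombination_directionalDerivativeHom_pow (i : m) (e : ℕ)
    (h : SymmetricAlgebra K (Module.Dual K V)) :
    pullbackCombination D ((directionalDerivativeHom (K := K) (D i) ^ e) h) =
      (MvPolynomial.pderiv i)^[e] (pullbackCombination D h) := by
  induction e generalizing h with
  | zero => simp
  | succ e ih =>
    rw [pow_succ, Module.End.mul_apply, ih, directionalDerivativeHom_apply,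
      pullbackCombination_directionalDerivative, Function.iterate_succ_apply]

theorem isHomogeneous_pullbackCombination {d : ℕ} :
    ∀ {h : SymmetricAlgebra K (Module.Dual K V)}, h ∈ symComponent K (Module.Dual K V) d →
      (pullbackCombination D h).IsHomogeneous d := by
  unfold symComponent
  induction d with
  | zero =>
    intro h hh
    rw [pow_zero] at hh
    obtain ⟨c, rfl⟩ := Submodule.mem_one.1 hh
    rw [AlgHom.commutes]
    exact MvPolynomial.isHomogeneous_C _ _
  | succ d ih =>
    intro h hh
    rw [pow_succ'] at hh
    induction hh using Submodule.mul_induction_on' with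
    | mem_mul_mem p hp q hq =>
      obtain ⟨y, rfl⟩ := hp
      rw [map_mul, pullbackCombination_ι, add_comm d]
      refine MvPolynomial.IsHomogeneous.mul (MvPolynomial.IsHomogeneous.sum _ _ _ fun i _ => ?_)
        (ih hq)
      rw [MvPolynomial.smul_eq_C_mul]
      exact (MvPolynomial.isHomogeneous_X K i).C_mul _
    | add p _ q _ hp hq => rw [map_add]; exact hp.add hq

theorem translate_pullbackCombination {c : m → K} (hc : c ∈ nagataGroup K D)
    (h : SymmetricAlgebra K (Module.Dual K V)) :
    translate c (pullbackCombination D h) = pullbackCombination D h := by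
  have hc : ∑ i, c i • D i = 0 := by
    simpa [nagataGroup, Fintype.linearCombination_apply] using hc
  suffices H : (translate c).comp (pullbackCombination D) = pullbackCombination D from
    DFunLike.congr_fun H h
  apply SymmetricAlgebra.algHom_ext
  ext1 y
  have hy : ∑ i, y (D i) * c i = 0 := by
    have := congrArg y hc
    simpa [mul_comm] using this
  change translate c (pullbackCombination D (SymmetricAlgebra.ι K _ y)) =
    pullbackCombination D (SymmetricAlgebra.ι K _ y)
  simp only [pullbackCombination_ι, map_sum, map_smul, translate, MvPolynomial.aeval_X, smul_add,
    Finset.sum_add_distrib]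
  rw [add_eq_left]
  simp only [MvPolynomial.smul_eq_C_mul, ← map_mul, ← map_sum, hy, map_zero]

variable {σ : V →ₗ[K] m → K}

theorem pullbackCoordinates_pullbackCombination (hσ : ∀ v, ∑ i, σ v i • D i = v)
    (h : SymmetricAlgebra K (Module.Dual K V)) :
    pullbackCoordinates σ (pullbackCombination D h) = h := by
  suffices H : (pullbackCoordinates σ).comp (pullbackCombination D) = AlgHom.id K _ from
    DFunLike.congr_fun H h
  apply SymmetricAlgebra.algHom_ext
  ext1 y
  change pullbackCoordinates σ (pullbackCombination D (SymmetricAlgebra.ι K _ y)) =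
    SymmetricAlgebra.ι K _ y
  simp only [pullbackCombination_ι, map_sum, map_smul, pullbackCoordinates, MvPolynomial.aeval_X]
  simp only [← map_smul, ← map_sum]
  congr 1
  ext v
  conv_rhs => rw [← hσ v]
  simp [mul_comm]

theorem pullbackCombination_pullbackCoordinates [Infinite K] (hσ : ∀ v, ∑ i, σ v i • D i = v)
    {g : MvPolynomial m K} (hg : ∀ c ∈ nagataGroup K D, translate c g = g) :
    pullbackCombination D (pullbackCoordinates σ g) = g := by
  refine MvPolynomial.funext fun y => ?_
  -- The point `z` is the chosen representative of the class of `y` modulo `G`; invariance gives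
  -- `g(y) = g(z)`, and agreement at all points suffices over an infinite field.
  set z := σ (∑ j, y j • D j) with hz
  have hc : z - y ∈ nagataGroup K D := by
    rw [nagataGroup, LinearMap.mem_ker, map_sub, Fintype.linearCombination_apply,
      Fintype.linearCombination_apply, hz, hσ, sub_self]
  have h₁ : MvPolynomial.aeval y (pullbackCombination D (pullbackCoordinates σ g)) =
      MvPolynomial.aeval z g := by
    suffices H : ((MvPolynomial.aeval y).comp (pullbackCombination D)).comp
        (pullbackCoordinates σ) = MvPolynomial.aeval z from DFunLike.congr_fun H g
    apply MvPolynomial.algHom_ext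
    intro i
    simp [pullbackCoordinates, hz, mul_comm]
  have h₂ : MvPolynomial.aeval y (translate (z - y) g) = MvPolynomial.aeval z g := by
    suffices H : (MvPolynomial.aeval y).comp (translate (z - y)) =
        MvPolynomial.aeval (R := K) z from DFunLike.congr_fun H g
    apply MvPolynomial.algHom_ext
    intro i
    simp [translate]
  rw [hg _ hc] at h₂
  exact h₁.trans h₂.symm

end LinearSubstitution

/-! ### The isomorphism and the final comparison of exponents. -/

/-- The homogeneous components of the Cox-Nagata ring are inverse systems of power ideals. -/
theorem nonempty_coxNagataComponent_equiv {K V m : Type*} [Field K] [CharZero K] [AddCommGroup V]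
    [Module K V] [Fintype m] {D : m → V} (hD : Submodule.span K (Set.range D) = ⊤) (d : ℕ)
    (u : m → ℤ) (S : Submodule K (SymmetricAlgebra K (Module.Dual K V)))
    (hS : ∀ f, f ∈ S ↔ f ∈ symComponent K (Module.Dual K V) d ∧
      ∀ i, (directionalDerivativeHom (K := K) (D i) ^ (u i + 1).toNat) f = 0) :
    Nonempty (coxNagataComponent K D d u ≃ₗ[K] S) := by
  have hsurj : LinearMap.range (Fintype.linearCombination K D) = ⊤ := by
    rw [Fintype.range_linearCombination, hD]
  obtain ⟨σ, hσ'⟩ := (Fintype.linearCombination K D).exists_rightInverse_of_surjective hsurj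
  have hσ : ∀ v, ∑ i, σ v i • D i = v := fun v => LinearMap.congr_fun hσ' v
  let A := homogenize K u ∘ₗ (pullbackCombination (K := K) D).toLinearMap
  let B := (pullbackCoordinates σ).toLinearMap ∘ₗ (dehomogenize K m).toLinearMap
  have hA : ∀ f ∈ S, A f ∈ coxNagataComponent K D d u := by
    intro f hf
    obtain ⟨hfd, hf⟩ := (hS f).1 hf
    have hsupp : ∀ k ∈ (pullbackCombination D f).support,
        k.degree = d ∧ ∀ i, k i < (u i + 1).toNat := by
      intro k hk
      refine ⟨?_, fun i => ?_⟩
      · rw [Finsupp.degree_eq_weight_one]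
        exact isHomogeneous_pullbackCombination hfd (MvPolynomial.mem_support_iff.1 hk)
      · refine (iterate_pderiv_eq_zero_iff i _ _).1 ?_ k hk
        rw [← pullbackCombination_directionalDerivativeHom_pow, hf i, map_zero]
    have hhom := isWeightedHomogeneous_homogenize hsupp
    refine ⟨fun c hc => ?_, hhom⟩
    have hcoarse := isWeightedHomogeneous_coarseDegree hhom
    change nagataAction c (homogenize K u (pullbackCombination D f)) =
      homogenize K u (pullbackCombination D f)
    -- Both sides have coarse degree `u`, so invariance may be checked after setting `s_i = 1`,
    -- where the action is translation by `c`.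
    rw [← homogenize_dehomogenize (isWeightedHomogeneous_nagataAction c hcoarse),
      dehomogenize_nagataAction, dehomogenize_homogenize, translate_pullbackCombination hc]
  have hinv : ∀ f ∈ coxNagataComponent K D d u,
      pullbackCombination D (B f) = dehomogenize K m f := by
    intro f hf
    refine pullbackCombination_pullbackCoordinates hσ fun c hc => ?_
    change translate c (dehomogenize K m f) = dehomogenize K m f
    rw [← dehomogenize_nagataAction]
    exact congrArg _ (hf.1 c hc)
  have hB : ∀ f ∈ coxNagataComponent K D d u, B f ∈ S := by
    intro f hf
    have hsupp := support_dehomogenize hf.2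
    refine (hS _).2 ⟨pullbackCoordinates_mem_symComponent σ fun k hk => (hsupp k hk).1,
      fun i => ?_⟩
    rw [← pullbackCoordinates_pullbackCombination hσ
      ((directionalDerivativeHom (K := K) (D i) ^ _) (B f)),
      pullbackCombination_directionalDerivativeHom_pow, hinv f hf,
      (iterate_pderiv_eq_zero_iff i _ _).2 fun k hk => (hsupp k hk).2 i, map_zero]
  refine ⟨LinearEquiv.ofLinearMap (B.restrict hB) (A.restrict hA) ?_ ?_⟩
  · refine LinearMap.ext fun f => Subtype.ext ?_
    change pullbackCoordinates σ (dehomogenize K m (homogenize K u (pullbackCombination D f.1))) = _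
    rw [dehomogenize_homogenize, pullbackCoordinates_pullbackCombination hσ]
    rfl
  · refine LinearMap.ext fun f => Subtype.ext ?_
    change homogenize K u (pullbackCombination D (B f.1)) = _
    rw [hinv f.1 f.2, homogenize_dehomogenize (isWeightedHomogeneous_coarseDegree f.2.2)]
    rfl

end Zonotopal

end

theorem mainTheorem12 {K V ι : Type*} [Field K] [CharZero K] [AddCommGroup V] [Module K V]
    [FiniteDimensional K V] [Nontrivial V] [Fintype ι]
    (X : ι → Module.Dual K V) (hX : Submodule.span K (Set.range X) = ⊤)
    (D : Zonotopal.Hyperplane X → V) (hD : ∀ H, Zonotopal.IsDefiningNormal X H.1 (D H))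
    (C₀ : Set ι) (hC₀ : Zonotopal.IsFlat X C₀)
    (b : Zonotopal.Hyperplane X → ℤ) (hb : ∀ H, b H = 0 ∨ b H = 1)
    (hbC₀ : ∀ H, b H = 1 ↔ C₀ ⊆ H.1)
    (a : ι → ℕ) (d : ℕ) :
    Nonempty
      (Zonotopal.coxNagataComponent K D d
          ((Zonotopal.nonContainmentMatrix X).mulVec (fun i => (a i : ℤ)) -
            (2 : ℤ) • (1 : Zonotopal.Hyperplane X → ℤ) + b) ≃ₗ[K]
        (Zonotopal.kernel (Zonotopal.powerIdeal (Zonotopal.replicate X a) (-1)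
            (Zonotopal.replicateFlats X a (Zonotopal.flatsAbove X C₀))) ⊓
          Zonotopal.symComponent K (Module.Dual K V) d :
            Submodule K (SymmetricAlgebra K (Module.Dual K V)))) := by
  have hX' : ∀ v, (∀ i, X i v = 0) → v = 0 := fun v hv => Zonotopal.eq_zero_of_span_eq_top hX hv
  refine Zonotopal.nonempty_coxNagataComponent_equiv
    (Zonotopal.span_range_normals_eq_top hX' hD) d _ _ fun f => ?_
  rw [Submodule.mem_inf, and_comm]
  refine and_congr_right fun hf => ?_
  rw [Zonotopal.mem_kernel_powerIdeal_iff _ _ _ hf,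
    ← Zonotopal.forall_hyperplane_pow_eq_zero_iff hX' hD hb hbC₀ hf]
  refine forall_congr' fun H => ?_
  -- The exponent `u_H + 1` turns the `-2` of the multidegree into the `k = -1` of the power ideal.
  have hexp : ((Zonotopal.nonContainmentMatrix X).mulVec (fun i => (a i : ℤ)) -
      (2 : ℤ) • (1 : Zonotopal.Hyperplane X → ℤ) + b) H + 1 =
        ((Zonotopal.flatOf (Zonotopal.replicate X a) (D H))ᶜ.ncard : ℤ) - 1 + b H := by
    rw [← Zonotopal.nonContainmentMatrix_mulVec a (hD H)]
    simp only [Pi.add_apply, Pi.sub_apply, Pi.smul_apply, Pi.one_apply, smul_eq_mul]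
    ring
  rw [hexp]
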